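/- Let $h(t)$, $t\in\mathbb R$, be a unit-power Rayleigh fading channel, i.e. a zero-mean, circularly symmetric complex Gaussian process ($\mathbb E[h(s)h(t)]=0$ for all $s,t$) with $\mathbb E|h(t)|^2=1$ and $\mathbb E[h(t)h^\star(t-\tau)]=\rho_h(\tau)$ for all $t,\tau$. Let $T_s>0$ and, for an SNR $\eta>0$ and $l\in\mathbb Z$, let $\mathcal I_l=\log_2\left(1+\eta|h(lT_s)|^2\right)$ be the instantaneous mutual information. For $l,i\in\mathbb Z$ put $$r_{\mathcal I}(i)=\mathbb E[\mathcal I_l\mathcal I_{l-i}],\qquad \tilde r_{\mathcal I}(i)=\frac{r_{\mathcal I}(i)}{\mathbb E[\mathcal I_l^2]},\qquad \rho_{\mathcal I}(i)=\frac{r_{\mathcal I}(i)-(\mathbb E\mathcal I_l)^2}{\mathbb E[\mathcal I_l^2]-(\mathbb E\mathcal I_l)^2}.$$ Let $\gamma=e^{C}=1.781072\ldots$, where $C=0.5772\ldots$ is the Euler–Mascheroni constant, let $\mathrm{Li}_2(x)=\sum_{k\ge1}x^k/k^2$ for $|x|\le1$, and let $H_k=\sum_{j=1}^k 1/j$, $H_0=0$.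 Suppose that $i$ is such that $\varrho_i=|\rho_h(iT_s)|<1$. Then the following hold. (a) For every $\eta>0$, $\mathcal I_l$ and $\mathcal I_{l-i}$ are square integrable, $\mathbb E[\mathcal I_l^2]>0$ and $\mathbb E[\mathcal I_l^2]-(\mathbb E\mathcal I_l)^2>0$. (b) As $\eta\to\infty$, $$\frac{r_{\mathcal I}(i)}{(\log_2e)^2}=\mathrm{Li}_2(\varrho_i^2)+\ln^2\frac{\eta}{\gamma}+o(1),\qquad \frac{\mathbb E[\mathcal I_l^2]}{(\log_2e)^2}=\frac{\pi^2}{6}+\ln^2\frac{\eta}{\gamma}+o(1).$$ (c) As $\eta\to\infty$, $$\tilde r_{\mathcal I}(i)=\frac{\mathrm{Li}_2(\varrho_i^2)+\ln^2\frac{\eta}{\gamma}}{\frac{\pi^2}{6}+\ln^2\frac{\eta}{\gamma}}+o\!\left(\frac1{\ln^2(\eta/\gamma)}\right).$$ (d) $\displaystyle\lim_{\eta\to\infty}\rho_{\mathcal I}(i)=\frac{6\,\mathrm{Li}_2(\varrho_i^2)}{\pi^2}.$ (e) For every real $t$ with $|t|<1$, the series below converge and $$\sum_{k\ge0}H_kt^k=-\frac{\ln(1-t)}{1-t},\qquad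 \sum_{k\ge0}H_k^2t^k=\frac{\mathrm{Li}_2(t)+\ln^2(1-t)}{1-t}.$$ -/

import Mathlib

open MeasureTheory ProbabilityTheory Filter Topology

/-- A unit-power (flat) Rayleigh fading channel `h(t)` with correlation function `ρh`: a zero-mean,
circularly symmetric, wide-sense stationary complex Gaussian process with
`E[h(t) h*(t - τ)] = ρh(τ)` and `E[|h(t)|²] = 1`. For a zero-mean complex Gaussian process, circular
symmetry means that the pseudo-covariance `E[h(t) h(s)]` vanishes. -/
structure IsRayleighFading {Ω : Type*} [MeasurableSpace Ω] (P : Measure Ω)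
    (h : ℝ → Ω → ℂ) (ρh : ℝ → ℂ) : Prop where
  gaussian : IsGaussianProcess h P
  zero_mean : ∀ t, ∫ ω, h t ω ∂P = 0
  circular : ∀ s t, ∫ ω, h s ω * h t ω ∂P = 0
  unit_power : ∀ t, ∫ ω, ‖h t ω‖ ^ 2 ∂P = 1
  correlation : ∀ t τ, ∫ ω, h t ω * (starRingEnd ℂ) (h (t - τ) ω) ∂P = ρh τ

/-- The SISO instantaneous mutual information `I_l = log₂(1 + η |h(l Ts)|²)`. -/
noncomputable def imi {Ω : Type*} (h : ℝ → Ω → ℂ) (Ts η : ℝ) (l : ℤ) (ω : Ω) : ℝ :=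
  Real.logb 2 (1 + η * ‖h (l * Ts) ω‖ ^ 2)

/-- The autocorrelation function `r(i) = E[I_l I_{l-i}]` (at time index `l`). -/
noncomputable def imiACF {Ω : Type*} [MeasurableSpace Ω] (P : Measure Ω)
    (h : ℝ → Ω → ℂ) (Ts η : ℝ) (l i : ℤ) : ℝ :=
  ∫ ω, imi h Ts η l ω * imi h Ts η (l - i) ω ∂P

/-- The normalized autocorrelation function `r(i) / E[I_l²]`. -/
noncomputable def imiNACF {Ω : Type*} [MeasurableSpace Ω] (P : Measure Ω)
    (h : ℝ → Ω → ℂ) (Ts η : ℝ) (l i : ℤ) : ℝ :=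
  imiACF P h Ts η l i / ∫ ω, imi h Ts η l ω ^ 2 ∂P

/-- The correlation coefficient `(r(i) - E[I_l]²) / (E[I_l²] - E[I_l]²)`. -/
noncomputable def imiCorrCoeff {Ω : Type*} [MeasurableSpace Ω] (P : Measure Ω)
    (h : ℝ → Ω → ℂ) (Ts η : ℝ) (l i : ℤ) : ℝ :=
  (imiACF P h Ts η l i - (∫ ω, imi h Ts η l ω ∂P) ^ 2) /
    ((∫ ω, imi h Ts η l ω ^ 2 ∂P) - (∫ ω, imi h Ts η l ω ∂P) ^ 2)

/-- The dilogarithm `Li₂(x) = ∑_{k ≥ 1} x^k / k²`, for `|x| ≤ 1`. -/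
noncomputable def dilog (x : ℝ) : ℝ := ∑' k : ℕ, x ^ (k + 1) / ((k : ℝ) + 1) ^ 2

/-- The constant `γ = 1.781072…`, i.e. `γ = exp C` with `C = 0.5772…` the Euler–Mascheroni
constant in today's convention. -/
noncomputable def gammaConst : ℝ := Real.exp Real.eulerMascheroniConstant

/-! ### Power series: harmonic numbers and the dilogarithm -/

/-! Measured in nats, the rate is `log (1 + η X)` with `X = |h|²` standard exponential. It differs
from `log η + log X` by at most `4 (η X)^(-1/4)`, and `X^(-1/4)` is square integrable. A product of
two rates therefore has mean `log² η - 2 C log η + E[log X log Y] + o(1)`, using `E[log X] = -C`.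
Completing the square gives `ln² (η/γ)` plus the covariance of `log X` and `log Y`, so all the
asymptotics reduce to two numbers: this covariance is `Li₂(ϱ²)` for two distinct samples and `π²/6`
for a repeated one.

For the covariance, write the second sample as `b Z + D`, with `D` the residual of the linear
regression on `Z`. Circular symmetry makes `D` independent of `Z` and circularly symmetric of
variance `1 - p`, where `p = ϱ²`. Given `Z` and `|D|`, the phase of `D` is uniform, and Jensen's
formula replaces the mean of `log |b Z + D|²` by `log |D|² + log⁺ (|b Z|²/|D|²)`. Only two
independent exponential variables remain. Writing `log⁺` as an integral of `du/u` and applying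
Fubini twice leaves a one-variable integral with an explicit dilogarithm antiderivative
(`setIntegral_eq_dilog`). The case `π²/6` is the limit `p → 1` of the same identity
(`integral_log_sq_stdExp`).

The two quotients then follow from `tendsto_sq_mul_div_sub_div` and `tendsto_sub_sq_of_tendsto`. The
second needs the error of the mean to be `o(1/log η)`, which the `η^(-1/4)` bound supplies. The
generating functions of `H_k` and `H_k²` are independent of all this: multiplication by `1 - t`
turns a coefficient sequence into its differences. -/

lemma harmonic_cast_nonneg (k : ℕ) : 0 ≤ (harmonic k : ℝ) := by
  rw [harmonic]; push_cast
  exact Finset.sum_nonneg fun i _ => by positivity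

lemma harmonic_cast_succ (k : ℕ) :
    (harmonic (k + 1) : ℝ) = (harmonic k : ℝ) + ((k : ℝ) + 1)⁻¹ := by
  rw [harmonic_succ]; push_cast; rfl

lemma harmonic_cast_le (k : ℕ) : (harmonic k : ℝ) ≤ k := by
  induction k with
  | zero => simp
  | succ k ih =>
    rw [harmonic_cast_succ]; push_cast
    have : ((k : ℝ) + 1)⁻¹ ≤ 1 := inv_le_one_of_one_le₀ (by linarith [k.cast_nonneg (α := ℝ)])
    linarith

lemma summable_harmonic_mul_pow {t : ℝ} (ht : |t| < 1) :
    Summable fun k : ℕ => (harmonic k : ℝ) * t ^ k := by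
  refine .of_norm_bounded
    (summable_pow_mul_geometric_of_norm_lt_one (R := ℝ) (r := |t|) 1 (by simpa)) fun k => ?_
  rw [norm_mul, norm_pow, Real.norm_eq_abs, Real.norm_eq_abs, abs_of_nonneg (harmonic_cast_nonneg k),
    pow_one]
  gcongr
  exact harmonic_cast_le k

lemma summable_harmonic_sq_mul_pow {t : ℝ} (ht : |t| < 1) :
    Summable fun k : ℕ => (harmonic k : ℝ) ^ 2 * t ^ k := by
  refine .of_norm_bounded
    (summable_pow_mul_geometric_of_norm_lt_one (R := ℝ) (r := |t|) 2 (by simpa)) fun k => ?_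
  rw [norm_mul, norm_pow, norm_pow, Real.norm_eq_abs, Real.norm_eq_abs,
    abs_of_nonneg (harmonic_cast_nonneg k)]
  have h0 := harmonic_cast_nonneg k
  gcongr
  exact harmonic_cast_le k

/-- If `u 0 = 0`, multiplying the generating function of `u` by `1 - t` gives that of its
difference sequence. -/
lemma hasSum_mul_pow_of_hasSum_diff {u : ℕ → ℝ} {t S : ℝ} (ht : |t| < 1) (h0 : u 0 = 0)
    (hu : Summable fun k => u k * t ^ k)
    (hS : HasSum (fun k => (u (k + 1) - u k) * t ^ (k + 1)) S) :
    HasSum (fun k => u k * t ^ k) (S / (1 - t)) := by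
  have h1 : HasSum (fun k => u (k + 1) * t ^ (k + 1)) (∑' k, u k * t ^ k) := by
    have := (hasSum_nat_add_iff' 1).mpr hu.hasSum
    simpa [h0] using this
  have h2 : HasSum (fun k => u k * t ^ k * t) ((∑' k, u k * t ^ k) * t) := hu.hasSum.mul_right t
  have h3 := h1.sub h2
  have h4 : S = (∑' k, u k * t ^ k) - (∑' k, u k * t ^ k) * t := by
    refine hS.unique ?_
    convert! h3 using 1
    funext k
    ring
  have hne : (1 - t) ≠ 0 := by
    have := (abs_lt.mp ht).2
    linarith
  have h5 : S / (1 - t) = ∑' k, u k * t ^ k := by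
    rw [div_eq_iff hne, h4]; ring
  rw [h5]
  exact hu.hasSum

lemma hasSum_harmonic_mul_pow {t : ℝ} (ht : |t| < 1) :
    HasSum (fun k : ℕ => (harmonic k : ℝ) * t ^ k) (-Real.log (1 - t) / (1 - t)) := by
  refine hasSum_mul_pow_of_hasSum_diff ht (by simp) (summable_harmonic_mul_pow ht) ?_
  convert! Real.hasSum_pow_div_log_of_abs_lt_one ht using 2 with k
  rw [harmonic_cast_succ]
  ring

/-- Termwise differentiation of a power series with coefficients of at most linear growth. -/
lemma hasDerivAt_tsum_mul_pow_div {a : ℕ → ℝ} (ha : ∀ k : ℕ, |a k| ≤ k + 1) {x : ℝ}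
    (hx : |x| < 1) :
    HasDerivAt (fun y : ℝ => ∑' k : ℕ, a k * (y ^ (k + 1) / ((k : ℝ) + 1)))
      (∑' k : ℕ, a k * x ^ k) x := by
  obtain ⟨r, hxr, hr1⟩ := exists_between hx
  have hr0 : 0 < r := (abs_nonneg x).trans_lt hxr
  have hsum : Summable fun k : ℕ => ((k : ℝ) + 1) * r ^ k := by
    have h1 := summable_pow_mul_geometric_of_norm_lt_one (R := ℝ) (r := r) 1
      (by rwa [Real.norm_eq_abs, abs_of_pos hr0])
    have h2 := summable_geometric_of_lt_one hr0.le hr1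
    convert! h1.add h2 using 1
    funext k
    ring
  refine hasDerivAt_tsum_of_isPreconnected
    (g := fun k y => a k * (y ^ (k + 1) / ((k : ℝ) + 1))) (g' := fun k y => a k * y ^ k) (t := Set.Ioo (-r) r) (y₀ := 0) hsum isOpen_Ioo
    isPreconnected_Ioo (fun k y _ => ?_) (fun k y hy => ?_) ⟨by linarith, hr0⟩ ?_
    (abs_lt.mp hxr)
  · have h := ((hasDerivAt_pow (k + 1) y).div_const ((k : ℝ) + 1)).const_mul (a k)
    refine h.congr_deriv ?_
    have : (k : ℝ) + 1 ≠ 0 := by positivity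
    push_cast
    field_simp
  · rw [norm_mul, norm_pow, Real.norm_eq_abs, Real.norm_eq_abs]
    have := abs_lt.mpr ⟨hy.1, hy.2⟩
    gcongr
    exact ha k
  · simp

/-- The origin is excluded only because the quotient there is `0 / 0 = 0`, while the derivative is
`1`. -/
lemma hasDerivAt_dilog {x : ℝ} (hx : |x| < 1) (hx0 : x ≠ 0) :
    HasDerivAt dilog (-Real.log (1 - x) / x) x := by
  have h := hasDerivAt_tsum_mul_pow_div (a := fun k : ℕ => ((k : ℝ) + 1)⁻¹) (fun k => by
    rw [abs_of_nonneg (by positivity)]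
    have hk := k.cast_nonneg (α := ℝ)
    have : ((k : ℝ) + 1)⁻¹ ≤ 1 := inv_le_one_of_one_le₀ (by linarith)
    linarith) hx
  have h2 : (∑' k : ℕ, ((k : ℝ) + 1)⁻¹ * x ^ k) = -Real.log (1 - x) / x := by
    refine HasSum.tsum_eq ?_
    convert! (Real.hasSum_pow_div_log_of_abs_lt_one hx).div_const x using 1
    funext k
    field_simp
    ring
  rw [h2] at h
  convert! h using 1
  funext y
  unfold dilog
  congr 1; funext k
  field_simp

/-- The endpoint `1` is what later allows `p → 1`. Continuity at `0` lets the fundamental theorem of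
calculus start where the derivative formula fails. -/
lemma continuousOn_dilog : ContinuousOn dilog (Set.Icc (-1) 1) := by
  have hs : Summable fun k : ℕ => 1 / ((k : ℝ) + 1) ^ 2 := by
    have := (summable_nat_add_iff 1).mpr hasSum_zeta_two.summable
    simpa using this
  refine continuousOn_tsum (fun k => by fun_prop) hs fun k x hx => ?_
  rw [norm_div, norm_pow, norm_pow, Real.norm_eq_abs, Real.norm_eq_abs,
    abs_of_nonneg (by positivity : (0 : ℝ) ≤ (k : ℝ) + 1)]
  gcongr
  exact pow_le_one₀ (abs_nonneg _) (abs_le.mpr hx)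

lemma dilog_zero : dilog 0 = 0 := by simp [dilog]

lemma dilog_one : dilog 1 = Real.pi ^ 2 / 6 := by
  have := (hasSum_nat_add_iff' 1).mpr hasSum_zeta_two
  simp only [Finset.range_one, Finset.sum_singleton, Nat.cast_zero] at this
  norm_num at this
  simpa [dilog] using this.tsum_eq

lemma hasSum_dilog {x : ℝ} (hx : |x| < 1) :
    HasSum (fun k : ℕ => x ^ (k + 1) / ((k : ℝ) + 1) ^ 2) (dilog x) := by
  refine Summable.hasSum (.of_norm_bounded
    (summable_geometric_of_lt_one (abs_nonneg x) hx) fun k => ?_)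
  rw [norm_div, norm_pow, norm_pow, Real.norm_eq_abs, Real.norm_eq_abs,
    abs_of_nonneg (by positivity : (0 : ℝ) ≤ (k : ℝ) + 1)]
  have hk := k.cast_nonneg (α := ℝ)
  refine (div_le_self (by positivity) (one_le_pow₀ (by linarith))).trans ?_
  exact pow_le_pow_of_le_one (abs_nonneg _) hx.le (Nat.le_succ k)

/-- Both sides vanish at `0`, and termwise differentiation reduces their derivatives to the
generating function of `H_k`. -/
lemma hasSum_harmonic_mul_pow_div {t : ℝ} (ht : |t| < 1) :
    HasSum (fun k : ℕ => (harmonic k : ℝ) * (t ^ (k + 1) / ((k : ℝ) + 1)))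
      (Real.log (1 - t) ^ 2 / 2) := by
  have hb : ∀ k : ℕ, |(harmonic k : ℝ)| ≤ k + 1 := fun k => by
    rw [abs_of_nonneg (harmonic_cast_nonneg k)]
    linarith [harmonic_cast_le k]
  set F : ℝ → ℝ := fun y => ∑' k : ℕ, (harmonic k : ℝ) * (y ^ (k + 1) / ((k : ℝ) + 1)) with hF
  have hd : ∀ x ∈ Set.Ioo (-1 : ℝ) 1,
      HasDerivAt (fun y => F y - Real.log (1 - y) ^ 2 / 2) 0 x := by
    intro x hx
    have h1 := hasDerivAt_tsum_mul_pow_div hb (abs_lt.mpr hx)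
    rw [(hasSum_harmonic_mul_pow (abs_lt.mpr hx)).tsum_eq] at h1
    have hne : 1 - x ≠ 0 := by linarith [hx.2]
    have h2 := ((((hasDerivAt_id x).const_sub 1).log hne).pow 2).div_const 2
    refine (h1.sub h2).congr_deriv ?_
    simp only [id]
    field_simp
    push_cast
    ring
  have hc : F t - Real.log (1 - t) ^ 2 / 2 = F 0 - Real.log (1 - 0) ^ 2 / 2 :=
    isOpen_Ioo.is_const_of_deriv_eq_zero isPreconnected_Ioo
      (fun x hx => (hd x hx).differentiableAt.differentiableWithinAt)
      (fun x hx => (hd x hx).deriv) (abs_lt.mp ht) (by norm_num)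
  have hF0 : F 0 = 0 := by simp [hF]
  have hFt : F t = Real.log (1 - t) ^ 2 / 2 := by
    rw [hF0] at hc; simp at hc; linarith
  rw [← hFt]
  refine Summable.hasSum (.of_norm_bounded
    (summable_harmonic_mul_pow (t := |t|) (by simpa)) fun k => ?_)
  rw [norm_mul, norm_div, norm_pow, Real.norm_eq_abs, Real.norm_eq_abs, Real.norm_eq_abs,
    abs_of_nonneg (harmonic_cast_nonneg k),
    abs_of_nonneg (by positivity : (0 : ℝ) ≤ (k : ℝ) + 1)]
  have h0 := harmonic_cast_nonneg k
  have hk := k.cast_nonneg (α := ℝ)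
  gcongr
  refine (div_le_self (by positivity) (by linarith)).trans ?_
  exact pow_le_pow_of_le_one (abs_nonneg _) ht.le (Nat.le_succ k)

/-- The differences are `H_{k+1}² - H_k² = 1/(k+1)² + 2 H_k/(k+1)`, which split into the dilogarithm
series and twice the preceding one. -/
lemma hasSum_harmonic_sq_mul_pow {t : ℝ} (ht : |t| < 1) :
    HasSum (fun k : ℕ => (harmonic k : ℝ) ^ 2 * t ^ k)
      ((dilog t + Real.log (1 - t) ^ 2) / (1 - t)) := by
  refine hasSum_mul_pow_of_hasSum_diff ht (by simp) (summable_harmonic_sq_mul_pow ht) ?_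
  convert! (hasSum_dilog ht).add ((hasSum_harmonic_mul_pow_div ht).mul_left 2) using 2 with k
  · rw [harmonic_cast_succ]
    field_simp
    ring
  · ring

/-! ### The standard exponential law -/

/-- The standard exponential law on `ℝ`, with density `exp (-x)` on `(0, ∞)`. -/
noncomputable def stdExp : Measure ℝ :=
  (volume.restrict (Set.Ioi 0)).withDensity fun x => ENNReal.ofReal (Real.exp (-x))

lemma measurable_stdExp_density : Measurable fun x : ℝ => ENNReal.ofReal (Real.exp (-x)) := by
  fun_prop

lemma integral_stdExp (f : ℝ → ℝ) :
    ∫ x, f x ∂stdExp = ∫ x in Set.Ioi (0 : ℝ), Real.exp (-x) * f x := by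
  rw [stdExp, integral_withDensity_eq_integral_toReal_smul measurable_stdExp_density
    (ae_of_all _ fun x => ENNReal.ofReal_lt_top)]
  simp [ENNReal.toReal_ofReal (Real.exp_pos _).le]

lemma integrable_stdExp_iff (f : ℝ → ℝ) :
    Integrable f stdExp ↔ IntegrableOn (fun x => Real.exp (-x) * f x) (Set.Ioi 0) := by
  rw [stdExp, integrable_withDensity_iff_integrable_smul' measurable_stdExp_density
    (ae_of_all _ fun x => ENNReal.ofReal_lt_top), IntegrableOn]
  simp [ENNReal.toReal_ofReal (Real.exp_pos _).le]

lemma lintegral_stdExp {f : ℝ → ENNReal} (hf : Measurable f) :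
    ∫⁻ x, f x ∂stdExp = ∫⁻ x in Set.Ioi (0 : ℝ), ENNReal.ofReal (Real.exp (-x)) * f x := by
  rw [stdExp, lintegral_withDensity_eq_lintegral_mul _ measurable_stdExp_density hf]
  rfl

lemma stdExp_absolutelyContinuous : stdExp ≪ volume.restrict (Set.Ioi 0) :=
  withDensity_absolutelyContinuous _ _

lemma ae_pos_stdExp : ∀ᵐ x ∂stdExp, 0 < x :=
  stdExp_absolutelyContinuous.ae_le (ae_restrict_mem measurableSet_Ioi)

instance : NullSingletonClass stdExp where
  measure_singleton x := stdExp_absolutelyContinuous (by simp)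

instance : IsProbabilityMeasure stdExp where
  measure_univ := by
    rw [stdExp, withDensity_apply _ MeasurableSet.univ, Measure.restrict_univ,
      ← ofReal_integral_eq_lintegral_ofReal (integrableOn_exp_neg_Ioi 0)
        (ae_of_all _ fun x => (Real.exp_pos _).le), integral_exp_neg_Ioi_zero]
    simp

lemma integrable_rpow_stdExp {s : ℝ} (hs : -1 < s) : Integrable (fun x : ℝ => x ^ s) stdExp := by
  rw [integrable_stdExp_iff]
  simpa using Real.GammaIntegral_convergent (s := s + 1) (by linarith)

lemma integrable_pow_stdExp (n : ℕ) : Integrable (fun x : ℝ => x ^ n) stdExp := by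
  simpa using integrable_rpow_stdExp (s := n) (by linarith [n.cast_nonneg (α := ℝ)])

/-- The square `x^(-1/2)` is integrable at `0`; any exponent in `(-1/2, 0)` would serve. This
function controls both `log` near `0` and the high-SNR error. -/
lemma memLp_rpow_neg_fourth_stdExp : MemLp (fun x : ℝ => x ^ (-(1 / 4) : ℝ)) 2 stdExp := by
  rw [memLp_two_iff_integrable_sq (by fun_prop)]
  refine (integrable_rpow_stdExp (s := -(1 / 2)) (by norm_num)).congr ?_
  filter_upwards [ae_pos_stdExp] with x hx
  rw [← Real.rpow_natCast, ← Real.rpow_mul hx.le]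
  norm_num

lemma memLp_rpow_fourth_stdExp : MemLp (fun x : ℝ => x ^ (1 / 4 : ℝ)) 2 stdExp := by
  rw [memLp_two_iff_integrable_sq (by fun_prop)]
  refine (integrable_rpow_stdExp (s := 1 / 2) (by norm_num)).congr ?_
  filter_upwards [ae_pos_stdExp] with x hx
  rw [← Real.rpow_natCast, ← Real.rpow_mul hx.le]
  norm_num

lemma abs_log_le_rpow_fourth {x : ℝ} (hx : 0 < x) :
    |Real.log x| ≤ 4 * (x ^ (1 / 4 : ℝ) + x ^ (-(1 / 4) : ℝ)) := by
  have h1 := Real.log_le_rpow_div hx.le (ε := 1 / 4) (by norm_num)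
  have h2 := Real.log_le_rpow_div (inv_pos.mpr hx).le (ε := 1 / 4) (by norm_num)
  rw [Real.log_inv, Real.inv_rpow hx.le, ← Real.rpow_neg hx.le] at h2
  have h3 := Real.rpow_pos_of_pos hx (1 / 4)
  have h4 := Real.rpow_pos_of_pos hx (-(1 / 4))
  rw [abs_le]
  constructor <;> linarith

lemma memLp_log_stdExp : MemLp Real.log 2 stdExp := by
  refine ((memLp_rpow_fourth_stdExp.add memLp_rpow_neg_fourth_stdExp).const_mul 4).mono
    (by fun_prop) ?_
  filter_upwards [ae_pos_stdExp] with x hx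
  have h := abs_log_le_rpow_fourth hx
  rw [Real.norm_eq_abs, Real.norm_eq_abs]
  exact h.trans (le_abs_self _)

lemma integrable_log_stdExp : Integrable Real.log stdExp :=
  memLp_log_stdExp.integrable (by norm_num)

lemma memLp_id_stdExp : MemLp (fun x : ℝ => x) 2 stdExp := by
  rw [memLp_two_iff_integrable_sq (by fun_prop)]
  exact integrable_pow_stdExp 2

/-- Differentiating the Gamma integral under the integral sign at `1` gives this moment as `Γ'(1) =
-C`. -/
lemma integral_log_stdExp :
    ∫ x, Real.log x ∂stdExp = -Real.eulerMascheroniConstant := by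
  have h1 := Complex.hasDerivAt_GammaIntegral (s := 1) (by simp)
  have h2 : HasDerivAt Complex.GammaIntegral (-Real.eulerMascheroniConstant : ℂ) 1 := by
    refine Complex.hasDerivAt_Gamma_one.congr_of_eventuallyEq ?_
    filter_upwards [(isOpen_lt continuous_const Complex.continuous_re).mem_nhds
      (show (0 : ℝ) < (1 : ℂ).re by simp)] with s hs
    exact (Complex.Gamma_eq_integral hs).symm
  have h3 := h1.unique h2
  rw [integral_stdExp]
  have h4 : (∫ t : ℝ in Set.Ioi 0, (t : ℂ) ^ ((1 : ℂ) - 1) * (Real.log t * Real.exp (-t)))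
      = ((∫ x in Set.Ioi (0 : ℝ), Real.exp (-x) * Real.log x : ℝ) : ℂ) := by
    rw [← integral_complex_ofReal]
    congr 1; funext t
    rw [sub_self, Complex.cpow_zero]
    push_cast
    ring
  rw [h4] at h3
  exact_mod_cast h3

lemma integral_exp_neg_mul_log {a : ℝ} (ha : 0 < a) :
    ∫ x in Set.Ioi (0 : ℝ), Real.exp (-(a * x)) * Real.log x =
      -(Real.eulerMascheroniConstant + Real.log a) / a := by
  have h := integral_comp_mul_left_Ioi
    (fun y => Real.exp (-y) * (Real.log y - Real.log a)) 0 ha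
  rw [mul_zero, ← integral_stdExp, integral_sub integrable_log_stdExp (integrable_const _),
    integral_log_stdExp] at h
  refine (setIntegral_congr_fun measurableSet_Ioi fun x hx => ?_).trans (h.trans ?_)
  · rw [Real.log_mul ha.ne' (ne_of_gt hx)]
    ring
  · simp
    field_simp
    ring

/-- Exponential tilting of the logarithmic moment of the standard exponential law. -/
lemma integral_log_mul_one_sub_exp_stdExp {u : ℝ} (hu : 0 ≤ u) :
    ∫ x, Real.log x * (1 - Real.exp (-(u * x))) ∂stdExp =
      -Real.eulerMascheroniConstant +
        (Real.eulerMascheroniConstant + Real.log (1 + u)) / (1 + u) := by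
  have hi : Integrable (fun x => Real.log x * Real.exp (-(u * x))) stdExp := by
    refine integrable_log_stdExp.mul_bdd (c := 1) (by fun_prop) ?_
    filter_upwards [ae_pos_stdExp] with x hx
    rw [Real.norm_eq_abs, Real.abs_exp, Real.exp_le_one_iff]
    nlinarith
  have h : ∫ x, Real.log x * Real.exp (-(u * x)) ∂stdExp =
      -(Real.eulerMascheroniConstant + Real.log (1 + u)) / (1 + u) := by
    rw [← integral_exp_neg_mul_log (by linarith : 0 < 1 + u), integral_stdExp]
    congr 1; funext x
    rw [show -((1 + u) * x) = -x + -(u * x) by ring, Real.exp_add]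
    ring
  calc _ = ∫ x, (Real.log x - Real.log x * Real.exp (-(u * x))) ∂stdExp := by
        congr 1; funext x; ring
    _ = _ := by
        rw [integral_sub integrable_log_stdExp hi, integral_log_stdExp, h]
        ring

lemma stdExp_real_Iio {t : ℝ} (ht : 0 ≤ t) : stdExp.real (Set.Iio t) = 1 - Real.exp (-t) := by
  have h : ∫ x, (Set.Iio t).indicator 1 x ∂stdExp = stdExp.real (Set.Iio t) := by
    simp [integral_indicator_one measurableSet_Iio]
  rw [← h, integral_stdExp]
  have h2 : ∀ x, Real.exp (-x) * (Set.Iio t).indicator 1 x =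
      (Set.Iio t).indicator (fun x => Real.exp (-x)) x := by
    intro x
    by_cases hx : x < t <;> simp [Set.indicator, hx]
  simp_rw [h2]
  rw [setIntegral_indicator measurableSet_Iio, Set.Ioi_inter_Iio, ← integral_Ioc_eq_integral_Ioo,
    ← intervalIntegral.integral_of_le ht, intervalIntegral.integral_comp_neg]
  simp

/-! ### A logarithmic double integral against the exponential law -/

/-- The condition `y < u x` restricts `u` to `(y/x, c]`, over which `du/u` integrates to the
logarithm, or to zero if the interval is empty. In this form `y` enters only through an indicator,
so Fubini leads to the exponential distribution function. -/
lemma integral_ite_inv_eq_posLog {c x y : ℝ} (hc : 0 ≤ c) (hx : 0 < x) (hy : 0 < y) :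
    ∫ u in Set.Ioc 0 c, (if y < u * x then u⁻¹ else 0) = Real.posLog (c * x / y) := by
  have h1 : ∀ u : ℝ, (if y < u * x then u⁻¹ else 0) =
      (Set.Ioi (y / x)).indicator (fun u => u⁻¹) u := by
    intro u
    by_cases h : y < u * x
    · rw [if_pos h, Set.indicator_of_mem (by rwa [Set.mem_Ioi, div_lt_iff₀ hx])]
    · rw [if_neg h, Set.indicator_of_notMem (by rwa [Set.mem_Ioi, div_lt_iff₀ hx])]
  have hyx : 0 < y / x := div_pos hy hx
  simp_rw [h1]
  rw [setIntegral_indicator measurableSet_Ioi, Set.Ioc_inter_Ioi, max_eq_right hyx.le]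
  rcases le_total (y / x) c with h | h
  · rw [← intervalIntegral.integral_of_le h, integral_inv_of_pos hyx (hyx.trans_le h),
      Real.posLog_eq_log]
    · congr 1; field_simp
    · rw [abs_of_nonneg (by positivity), le_div_iff₀ hy, one_mul]
      rwa [div_le_iff₀ hx] at h
  · rw [Set.Ioc_eq_empty (not_lt.mpr h), setIntegral_empty, eq_comm, Real.posLog_eq_zero_iff,
      abs_of_nonneg (by positivity), div_le_one hy]
    rwa [le_div_iff₀ hx] at h

lemma integral_ite_inv_stdExp {x u : ℝ} (hx : 0 ≤ x) (hu : 0 ≤ u) :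
    ∫ y, (if y < u * x then u⁻¹ else 0) ∂stdExp = (1 - Real.exp (-(u * x))) / u := by
  have h1 : ∀ y : ℝ, (if y < u * x then u⁻¹ else 0) =
      (Set.Iio (u * x)).indicator (fun _ => u⁻¹) y := fun y => by
    simp [Set.indicator]
  simp_rw [h1]
  rw [integral_indicator_const _ measurableSet_Iio, stdExp_real_Iio (by positivity), smul_eq_mul,
    div_eq_mul_inv]

/-- The inequality `1 - e^(-s) ≤ s` removes the singularity at `u = 0`; it justifies both
applications of Fubini. -/
lemma one_sub_exp_neg_mul_div_mem {x u : ℝ} (hx : 0 ≤ x) (hu : 0 < u) :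
    |(1 - Real.exp (-(u * x))) / u| ≤ x := by
  have h0 : 0 ≤ 1 - Real.exp (-(u * x)) := by
    rw [sub_nonneg, Real.exp_le_one_iff]; nlinarith
  rw [abs_of_nonneg (by positivity), div_le_iff₀ hu]
  linarith [Real.add_one_le_exp (-(u * x))]

lemma integral_posLog_stdExp {c x : ℝ} (hc : 0 ≤ c) (hx : 0 < x) :
    ∫ y, Real.posLog (c * x / y) ∂stdExp =
      ∫ u in Set.Ioc 0 c, (1 - Real.exp (-(u * x))) / u := by
  have hm : Measurable fun z : ℝ × ℝ => if z.2 < z.1 * x then z.1⁻¹ else 0 :=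
    Measurable.ite (measurableSet_lt (by fun_prop) (by fun_prop)) (by fun_prop) (by fun_prop)
  have hi : Integrable (Function.uncurry fun u y : ℝ => if y < u * x then u⁻¹ else 0)
      ((volume.restrict (Set.Ioc 0 c)).prod stdExp) := by
    refine (integrable_prod_iff hm.aestronglyMeasurable).mpr ⟨ae_of_all _ fun u => ?_, ?_⟩
    · refine Integrable.of_bound (C := |u⁻¹|) (hm.comp measurable_prodMk_left).aestronglyMeasurable
        (ae_of_all _ fun y => ?_)
      dsimp only
      split_ifs <;> simp
    · refine Integrable.of_bound (C := x) hm.norm.aestronglyMeasurable.integral_prod_right' ?_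
      filter_upwards [ae_restrict_mem measurableSet_Ioc] with u hu
      have : ∀ y : ℝ, ‖if y < u * x then u⁻¹ else 0‖ =
          if y < u * x then u⁻¹ else 0 := fun y => by
        split_ifs
        · rw [Real.norm_eq_abs, abs_of_nonneg (inv_nonneg.mpr hu.1.le)]
        · simp
      rw [integral_congr_ae (ae_of_all _ this), integral_ite_inv_stdExp hx.le hu.1.le]
      exact one_sub_exp_neg_mul_div_mem hx.le hu.1
  calc _ = ∫ y, (∫ u in Set.Ioc 0 c, if y < u * x then u⁻¹ else 0) ∂stdExp := by
        refine integral_congr_ae ?_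
        filter_upwards [ae_pos_stdExp] with y hy
        rw [integral_ite_inv_eq_posLog hc hx hy]
    _ = ∫ u in Set.Ioc 0 c, ∫ y, (if y < u * x then u⁻¹ else 0) ∂stdExp :=
        (integral_integral_swap hi).symm
    _ = _ := setIntegral_congr_fun measurableSet_Ioc fun u hu =>
        integral_ite_inv_stdExp hx.le hu.1.le

lemma integrable_log_mul_id_stdExp : Integrable (fun x => x * Real.log x) stdExp :=
  memLp_id_stdExp.integrable_mul memLp_log_stdExp

lemma integral_log_mul_integral_posLog_stdExp {c : ℝ} (hc : 0 ≤ c) :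
    ∫ x, Real.log x * ∫ y, Real.posLog (c * x / y) ∂stdExp ∂stdExp =
      ∫ u in Set.Ioc 0 c, (-Real.eulerMascheroniConstant +
        (Real.eulerMascheroniConstant + Real.log (1 + u)) / (1 + u)) / u := by
  have hi : Integrable (Function.uncurry fun x u : ℝ =>
      Real.log x * ((1 - Real.exp (-(u * x))) / u))
      (stdExp.prod (volume.restrict (Set.Ioc 0 c))) := by
    have hd : Integrable (fun z : ℝ × ℝ => (z.1 * Real.log z.1) * 1)
      (stdExp.prod (volume.restrict (Set.Ioc 0 c))) :=
      integrable_log_mul_id_stdExp.mul_prod (integrable_const (1 : ℝ))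
    refine hd.mono (Measurable.aestronglyMeasurable (by unfold Function.uncurry; fun_prop)) ?_
    have h1 : ∀ᵐ z ∂(stdExp.prod (volume.restrict (Set.Ioc 0 c))), 0 < z.1 :=
      Measure.quasiMeasurePreserving_fst.ae ae_pos_stdExp
    have h2 : ∀ᵐ z ∂(stdExp.prod (volume.restrict (Set.Ioc 0 c))), z.2 ∈ Set.Ioc 0 c :=
      Measure.quasiMeasurePreserving_snd.ae (ae_restrict_mem measurableSet_Ioc)
    filter_upwards [h1, h2] with z hz1 hz2
    simp only [Function.uncurry, norm_mul, mul_one]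
    rw [mul_comm ‖z.1‖]
    gcongr
    exact (one_sub_exp_neg_mul_div_mem hz1.le hz2.1).trans (le_abs_self _)
  calc _ = ∫ x, (∫ u in Set.Ioc 0 c, Real.log x * ((1 - Real.exp (-(u * x))) / u)) ∂stdExp := by
        refine integral_congr_ae ?_
        filter_upwards [ae_pos_stdExp] with x hx
        rw [integral_posLog_stdExp hc hx, integral_const_mul]
    _ = ∫ u in Set.Ioc 0 c, ∫ x, Real.log x * ((1 - Real.exp (-(u * x))) / u) ∂stdExp :=
        integral_integral_swap hi
    _ = _ := by
        refine setIntegral_congr_fun measurableSet_Ioc fun u hu => ?_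
        rw [← integral_log_mul_one_sub_exp_stdExp hu.1.le, ← integral_div]
        congr 1; funext x; ring

/-- The integrand equals `log (1 + u) / (u (1 + u)) - C / (1 + u)`. With `x = u / (1 + u)` one has
`1 - x = 1 / (1 + u)` and `dx/x = du / (u (1 + u))`, so the first term is the differential of `dilog
x`. -/
lemma setIntegral_eq_dilog {c : ℝ} (hc : 0 ≤ c) :
    ∫ u in Set.Ioc 0 c, (-Real.eulerMascheroniConstant +
        (Real.eulerMascheroniConstant + Real.log (1 + u)) / (1 + u)) / u =
      dilog (c / (1 + c)) - Real.eulerMascheroniConstant * Real.log (1 + c) := by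
  set C := Real.eulerMascheroniConstant
  have hmem : ∀ u : ℝ, 0 ≤ u → u / (1 + u) ∈ Set.Ico (0 : ℝ) 1 := fun u hu =>
    ⟨by positivity, by rw [div_lt_one (by linarith)]; linarith⟩
  have hcont : ContinuousOn (fun u : ℝ => dilog (u / (1 + u)) - C * Real.log (1 + u))
      (Set.Icc 0 c) := by
    refine ContinuousOn.sub (continuousOn_dilog.comp
      (continuousOn_id.div (by fun_prop) fun u hu => ?_) fun u hu => ?_)
      (continuousOn_const.mul (ContinuousOn.log (by fun_prop) fun u hu => ?_))
    · linarith [hu.1]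
    · have := hmem u hu.1
      exact ⟨by linarith [this.1], this.2.le⟩
    · linarith [hu.1]
  have hderiv : ∀ u ∈ Set.Ioo 0 c,
      HasDerivAt (fun u : ℝ => dilog (u / (1 + u)) - C * Real.log (1 + u))
        ((-C + (C + Real.log (1 + u)) / (1 + u)) / u) u := by
    intro u hu
    have hu0 := hu.1
    have h1u : (1 + u) ≠ 0 := by linarith
    have hm := hmem u hu0.le
    have hd := hasDerivAt_dilog (x := u / (1 + u)) (by rw [abs_of_nonneg hm.1]; exact hm.2)
      (by positivity)
    have ha : HasDerivAt (fun u : ℝ => 1 + u) 1 u := (hasDerivAt_id u).const_add 1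
    have hq := (hasDerivAt_id u).div ha h1u
    have h := (hd.comp u hq).sub ((ha.log h1u).const_mul C)
    refine h.congr_deriv ?_
    rw [show 1 - u / (1 + u) = (1 + u)⁻¹ by field_simp; ring, Real.log_inv]
    simp only [id]
    field_simp
    ring
  have hbound : IntervalIntegrable
      (fun u => (-C + (C + Real.log (1 + u)) / (1 + u)) / u) volume 0 c := by
    rw [intervalIntegrable_iff_integrableOn_Ioc_of_le hc]
    refine Integrable.of_bound (C := |C| + 1) (Measurable.aestronglyMeasurable (by fun_prop)) ?_
    filter_upwards [ae_restrict_mem measurableSet_Ioc] with u hu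
    have hu0 := hu.1
    have hl0 : 0 ≤ Real.log (1 + u) := Real.log_nonneg (by linarith)
    have hl1 : Real.log (1 + u) ≤ u := by linarith [Real.log_le_sub_one_of_pos (by linarith : 0 < 1 + u)]
    have he : (-C + (C + Real.log (1 + u)) / (1 + u)) / u =
        -C / (1 + u) + Real.log (1 + u) / (u * (1 + u)) := by
      field_simp; ring
    rw [he]
    refine (norm_add_le _ _).trans (add_le_add ?_ ?_)
    · rw [norm_div, norm_neg, Real.norm_eq_abs, Real.norm_eq_abs, abs_of_pos (by linarith : 0 < 1 + u)]
      exact div_le_self (abs_nonneg _) (by linarith)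
    · rw [Real.norm_eq_abs, abs_of_nonneg (by positivity), div_le_one (by positivity)]
      nlinarith
  rw [← intervalIntegral.integral_of_le hc,
    intervalIntegral.integral_eq_sub_of_hasDerivAt_of_le hc hcont hderiv hbound]
  simp [dilog_zero]

lemma posLog_div_le (c x y : ℝ) :
    Real.posLog (c * x / y) ≤ |Real.log c| + |Real.log x| + |Real.log y| := by
  rw [Real.posLog]
  refine max_le (by positivity) ?_
  by_cases hc : c = 0
  · simp [hc]; positivity
  by_cases hx : x = 0
  · simp [hx]; positivity
  by_cases hy : y = 0
  · simp [hy]; positivity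
  rw [Real.log_div (by positivity) hy, Real.log_mul hc hx]
  linarith [le_abs_self (Real.log c), le_abs_self (Real.log x), neg_abs_le (Real.log y)]

lemma integrable_posLog_stdExp (c x : ℝ) :
    Integrable (fun y => Real.posLog (c * x / y)) stdExp := by
  refine ((integrable_const (|Real.log c| + |Real.log x|)).add integrable_log_stdExp.abs).mono'
    (Real.continuous_posLog.measurable.comp (by fun_prop)).aestronglyMeasurable (ae_of_all _ fun y => ?_)
  rw [Real.norm_eq_abs, abs_of_nonneg (Real.posLog_nonneg)]
  exact posLog_div_le c x y

lemma log_add_posLog_integrand {p x y : ℝ} (hp1 : p < 1) (hy : 0 < y) :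
    Real.log ((1 - p) * y) + Real.posLog (p * x / ((1 - p) * y)) =
      Real.log (1 - p) + Real.log y + Real.posLog (p / (1 - p) * x / y) := by
  have hq : 0 < 1 - p := by linarith
  rw [Real.log_mul hq.ne' hy.ne']
  congr 2
  field_simp

/-- The logarithmic correlation integral produced by Jensen's formula. -/
lemma integral_log_mul_integral_log_add_posLog {p : ℝ} (hp0 : 0 ≤ p) (hp1 : p < 1) :
    ∫ x, Real.log x * ∫ y, (Real.log ((1 - p) * y) +
        Real.posLog (p * x / ((1 - p) * y))) ∂stdExp ∂stdExp =
      Real.eulerMascheroniConstant ^ 2 + dilog p := by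
  set C := Real.eulerMascheroniConstant with hC
  have hq : 0 < 1 - p := by linarith
  -- With these odds, `1 + c = 1 / (1 - p)`: the dilogarithm argument `c / (1 + c)` is `p`, and the
  -- term `-C log (1 + c)` cancels the contribution of the constant `log (1 - p)`.
  set c := p / (1 - p) with hcdef
  have hc : 0 ≤ c := by positivity
  have h1c : 1 + c = (1 - p)⁻¹ := by rw [hcdef]; field_simp; ring
  have hinner : ∀ x, ∫ y, (Real.log ((1 - p) * y) +
      Real.posLog (p * x / ((1 - p) * y))) ∂stdExp =
      (Real.log (1 - p) - C) + ∫ y, Real.posLog (c * x / y) ∂stdExp := by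
    intro x
    rw [integral_congr_ae (g := fun y => Real.log (1 - p) + Real.log y +
      Real.posLog (c * x / y))]
    · have hi := (integrable_const (μ := stdExp) (Real.log (1 - p))).add integrable_log_stdExp
      refine (integral_add hi (integrable_posLog_stdExp c x)).trans ?_
      simp only [Pi.add_apply]
      rw [integral_add (integrable_const _) integrable_log_stdExp, integral_log_stdExp]
      simp [hC]; ring
    · filter_upwards [ae_pos_stdExp] with y hy
      exact log_add_posLog_integrand hp1 hy
  simp_rw [hinner, mul_add]
  have hi2 : Integrable (fun x => Real.log x * ∫ y, Real.posLog (c * x / y) ∂stdExp) stdExp := by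
    refine ((integrable_log_mul_id_stdExp.abs).mul_const c).mono' ?_ ?_
    · refine Real.measurable_log.aestronglyMeasurable.mul ?_
      have : StronglyMeasurable (Function.uncurry fun x y : ℝ => Real.posLog (c * x / y)) :=
        (Real.continuous_posLog.measurable.comp (by fun_prop : Measurable fun z : ℝ × ℝ => c * z.1 / z.2)).stronglyMeasurable
      exact this.integral_prod_right.aestronglyMeasurable
    · filter_upwards [ae_pos_stdExp] with x hx
      rw [integral_posLog_stdExp hc hx, norm_mul, abs_mul, mul_comm |x|, mul_assoc]
      gcongr
      · exact le_refl _
      · have := norm_setIntegral_le_of_norm_le_const (μ := volume) (s := Set.Ioc 0 c) (C := x)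
          (f := fun u => (1 - Real.exp (-(u * x))) / u) (by simp)
          (fun u hu => one_sub_exp_neg_mul_div_mem hx.le hu.1)
        rw [abs_of_pos hx]
        simpa [hc] using this
  rw [integral_add (integrable_log_stdExp.mul_const _) hi2,
    integral_log_mul_integral_posLog_stdExp hc, setIntegral_eq_dilog hc, integral_mul_const,
    integral_log_stdExp, h1c, Real.log_inv,
    show c / (1 - p)⁻¹ = p by rw [hcdef]; field_simp]
  ring

/-- The left side looks singular as `a → 0`; the maximum shows that the limit `p → 1` is harmless.
-/
lemma log_add_posLog_eq_log_max {a b : ℝ} (ha : 0 < a) (hb : 0 ≤ b) :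
    Real.log a + Real.posLog (b / a) = Real.log (max a b) := by
  rcases le_total b a with h | h
  · rw [max_eq_left h, (Real.posLog_eq_zero_iff _).mpr, add_zero]
    rw [abs_of_nonneg (by positivity)]
    exact (div_le_one ha).mpr h
  · have hb' := ha.trans_le h
    rw [max_eq_right h, Real.posLog_eq_log, Real.log_div hb'.ne' ha.ne']
    · ring
    · rw [abs_of_nonneg (by positivity)]
      exact (one_le_div ha).mpr h

/-- The second moment of the logarithm of a standard exponential variable. -/
lemma integral_log_sq_stdExp :
    ∫ x, Real.log x * Real.log x ∂stdExp =
      Real.eulerMascheroniConstant ^ 2 + Real.pi ^ 2 / 6 := by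
  -- As `p → 1` this integrand tends to `log² z.1`, while its integral is already known to be `C² +
  -- dilog p`.
  set F : ℝ → ℝ × ℝ → ℝ := fun p z => Real.log z.1 * (Real.log ((1 - p) * z.2) +
    Real.posLog (p * z.1 / ((1 - p) * z.2))) with hF
  have hFm : ∀ p, Measurable (F p) := fun p => by
    refine Measurable.mul (by fun_prop) (Measurable.add (by fun_prop)
      (Real.continuous_posLog.measurable.comp (by fun_prop)))
  -- This is a majorant uniform in `p`: for `1/2 < p < 1` the maximum lies between `z.1 / 2` and the
  -- larger of `z.1` and `z.2`, whence the `log 2`.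
  set G : ℝ × ℝ → ℝ := fun z =>
    |Real.log z.1| * (Real.log 2 + |Real.log z.1| + |Real.log z.2|) with hG
  have hGi : Integrable G (stdExp.prod stdExp) := by
    have h1 : Integrable (fun z : ℝ × ℝ =>
        (|Real.log z.1| * Real.log 2 + |Real.log z.1 * Real.log z.1|) * 1)
        (stdExp.prod stdExp) :=
      ((integrable_log_stdExp.abs.mul_const _).add
        (memLp_log_stdExp.integrable_mul memLp_log_stdExp).abs).mul_prod
        (integrable_const (1 : ℝ))
    have h2 : Integrable (fun z : ℝ × ℝ => |Real.log z.1| * |Real.log z.2|)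
        (stdExp.prod stdExp) :=
      integrable_log_stdExp.abs.mul_prod integrable_log_stdExp.abs
    refine (h1.add h2).congr (ae_of_all _ fun z => ?_)
    simp only [hG, Pi.add_apply, abs_mul]
    ring
  have hae : ∀ᵐ z ∂(stdExp.prod stdExp), 0 < z.1 ∧ 0 < z.2 :=
    (Measure.quasiMeasurePreserving_fst.ae ae_pos_stdExp).and
      (Measure.quasiMeasurePreserving_snd.ae ae_pos_stdExp)
  have hmax : ∀ p ∈ Set.Ioo (1 / 2 : ℝ) 1, ∀ z : ℝ × ℝ, 0 < z.1 ∧ 0 < z.2 →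
      F p z = Real.log z.1 * Real.log (max ((1 - p) * z.2) (p * z.1)) := by
    rintro p ⟨hp0, hp1⟩ z ⟨hz1, hz2⟩
    have : 0 < 1 - p := by linarith
    simp only [hF]
    rw [log_add_posLog_eq_log_max (by positivity) (by positivity)]
  have hbd : ∀ p ∈ Set.Ioo (1 / 2 : ℝ) 1, ∀ᵐ z ∂(stdExp.prod stdExp), ‖F p z‖ ≤ G z := by
    intro p hp
    filter_upwards [hae] with z hz
    rw [hmax p hp z hz, norm_mul, Real.norm_eq_abs, Real.norm_eq_abs]
    obtain ⟨hz1, hz2⟩ := hz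
    obtain ⟨hp0, hp1⟩ := hp
    simp only [hG]
    gcongr
    have hpos : 0 < p * z.1 := by nlinarith
    have hl2 : 0 ≤ Real.log 2 := Real.log_nonneg (by norm_num)
    rw [abs_le]
    constructor
    · have h1 : Real.log (z.1 / 2) ≤ Real.log (max ((1 - p) * z.2) (p * z.1)) :=
        Real.log_le_log (by positivity) (le_max_of_le_right (by nlinarith))
      rw [Real.log_div hz1.ne' (by norm_num)] at h1
      linarith [neg_abs_le (Real.log z.1), abs_nonneg (Real.log z.2)]
    · rcases max_choice ((1 - p) * z.2) (p * z.1) with h | h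
      · have hm : 0 < (1 - p) * z.2 := mul_pos (by linarith) hz2
        have := Real.log_le_log hm (show (1 - p) * z.2 ≤ z.2 by nlinarith)
        rw [h]
        linarith [le_abs_self (Real.log z.2), abs_nonneg (Real.log z.1)]
      · have := Real.log_le_log hpos (show p * z.1 ≤ z.1 by nlinarith)
        rw [h]
        linarith [le_abs_self (Real.log z.1), abs_nonneg (Real.log z.2)]
  have hnear : ∀ᶠ p in 𝓝[<] (1 : ℝ), p ∈ Set.Ioo (1 / 2 : ℝ) 1 :=
    Ioo_mem_nhdsLT (by norm_num)
  have hlim : Tendsto (fun p => ∫ z, F p z ∂(stdExp.prod stdExp)) (𝓝[<] 1)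
      (𝓝 (∫ z : ℝ × ℝ, Real.log z.1 * Real.log z.1 ∂(stdExp.prod stdExp))) := by
    refine tendsto_integral_filter_of_dominated_convergence G
      (Eventually.of_forall fun p => (hFm p).aestronglyMeasurable)
      (hnear.mono hbd) hGi ?_
    filter_upwards [hae] with z hz
    have h1 : Tendsto (fun p : ℝ => Real.log z.1 * Real.log (max ((1 - p) * z.2) (p * z.1)))
        (𝓝 1) (𝓝 (Real.log z.1 * Real.log (max ((1 - 1) * z.2) (1 * z.1)))) := by
      refine Tendsto.const_mul _ (Tendsto.log ?_ ?_)
      · exact Continuous.tendsto (by fun_prop) 1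
      · simp [hz.1.le, hz.1.ne']
    rw [show max ((1 - 1) * z.2) (1 * z.1) = z.1 by simp [hz.1.le]] at h1
    refine (h1.mono_left nhdsWithin_le_nhds).congr' ?_
    filter_upwards [hnear] with p hp
    exact (hmax p hp z hz).symm
  have hval : ∀ p ∈ Set.Ioo (1 / 2 : ℝ) 1, ∫ z, F p z ∂(stdExp.prod stdExp) =
      Real.eulerMascheroniConstant ^ 2 + dilog p := by
    intro p hp
    rw [← integral_log_mul_integral_log_add_posLog (by linarith [hp.1]) hp.2, integral_prod]
    · simp only [hF, integral_const_mul]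
    · exact hGi.mono' (hFm p).aestronglyMeasurable (hbd p hp)
  have hlim2 : Tendsto (fun p => ∫ z, F p z ∂(stdExp.prod stdExp)) (𝓝[<] 1)
      (𝓝 (Real.eulerMascheroniConstant ^ 2 + dilog 1)) := by
    have h1 : Tendsto dilog (𝓝[<] 1) (𝓝 (dilog 1)) := by
      refine (continuousOn_dilog 1 (by norm_num)).mono_left ?_
      refine nhdsWithin_le_iff.mpr ?_
      filter_upwards [hnear] with p hp
      exact ⟨by linarith [hp.1], hp.2.le⟩
    refine (h1.const_add _).congr' ?_
    filter_upwards [hnear] with p hp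
    exact (hval p hp).symm
  have h := tendsto_nhds_unique hlim hlim2
  rw [dilog_one] at h
  rw [← h]
  simpa using (integral_fun_fst (μ := stdExp) (ν := stdExp)
    (fun x : ℝ => Real.log x * Real.log x)).symm

/-! ### Circularly symmetric complex Gaussian variables -/

/-- The uniform law on the angles `(-π, π)`. -/
noncomputable def unifAngle : Measure ℝ :=
  ENNReal.ofReal (2 * Real.pi)⁻¹ • volume.restrict (Set.Ioo (-Real.pi) Real.pi)

instance : IsProbabilityMeasure unifAngle where
  measure_univ := by
    have := Real.pi_pos
    rw [unifAngle, Measure.smul_apply, Measure.restrict_apply_univ, Real.volume_Ioo, smul_eq_mul,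
      ← ENNReal.ofReal_mul (by positivity), ← ENNReal.ofReal_one]
    congr 1
    field_simp
    ring

lemma integral_unifAngle_circleMap (f : ℂ → ℝ) (R : ℝ) :
    ∫ θ, f (circleMap 0 R θ) ∂unifAngle = Real.circleAverage f 0 R := by
  rw [Real.circleAverage_eq_integral_add (-Real.pi), unifAngle, integral_smul_measure,
    ENNReal.toReal_ofReal (by positivity),
    intervalIntegral.integral_comp_add_right (fun θ => f (circleMap 0 R θ)),
    intervalIntegral.integral_of_le (by linarith [Real.pi_pos]), integral_Ioc_eq_integral_Ioo]
  congr 4 <;> ring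

/-- The circularly symmetric complex Gaussian law of variance `v`, in polar form: the squared
modulus is `v` times a standard exponential variable, and the argument is uniform. -/
noncomputable def circGauss (v : ℝ) : Measure ℂ :=
  (stdExp.prod unifAngle).map fun z => circleMap 0 (Real.sqrt (v * z.1)) z.2

lemma measurable_circGauss_map (v : ℝ) :
    Measurable fun z : ℝ × ℝ => circleMap 0 (Real.sqrt (v * z.1)) z.2 := by
  unfold circleMap
  fun_prop

instance (v : ℝ) : IsProbabilityMeasure (circGauss v) :=
  Measure.isProbabilityMeasure_map (measurable_circGauss_map v).aemeasurable

lemma map_norm_sq_circGauss_one : (circGauss 1).map (fun z => ‖z‖ ^ 2) = stdExp := by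
  rw [circGauss, Measure.map_map (by fun_prop) (measurable_circGauss_map 1),
    Measure.map_congr (g := Prod.fst), Measure.map_fst_prod]
  · simp
  · filter_upwards [(Measure.quasiMeasurePreserving_fst (μ := stdExp) (ν := unifAngle)).ae
      ae_pos_stdExp] with z hz
    simp [Real.sq_sqrt hz.le]

/-- The substitution `x = r² / v` puts the radial variable in the shape produced by polar
coordinates on the plane. -/
lemma lintegral_circGauss {v : ℝ} (hv : 0 < v) {f : ℂ → ENNReal} (hf : Measurable f) :
    ∫⁻ z, f z ∂circGauss v = ∫⁻ r in Set.Ioi (0 : ℝ),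
      ENNReal.ofReal (2 * r / v) * (ENNReal.ofReal (Real.exp (-(r ^ 2 / v))) *
        (ENNReal.ofReal (2 * Real.pi)⁻¹ *
          ∫⁻ θ in Set.Ioo (-Real.pi) Real.pi, f (circleMap 0 r θ))) := by
  have hg : Measurable fun z : ℝ × ℝ => f (circleMap 0 (Real.sqrt (v * z.1)) z.2) :=
    hf.comp (measurable_circGauss_map v)
  rw [circGauss, lintegral_map hf (measurable_circGauss_map v), lintegral_prod _ hg.aemeasurable,
    lintegral_stdExp hg.lintegral_prod_right']
  have himg : (fun r : ℝ => r ^ 2 / v) '' Set.Ioi 0 = Set.Ioi 0 := by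
    ext x
    constructor
    · rintro ⟨r, hr, rfl⟩
      have : 0 < r := hr
      exact Set.mem_Ioi.mpr (by positivity)
    · intro hx
      have : 0 < x := hx
      refine ⟨Real.sqrt (v * x), Set.mem_Ioi.mpr (by positivity), ?_⟩
      simp only
      rw [Real.sq_sqrt (by positivity)]
      field_simp
  rw [← himg, lintegral_image_eq_lintegral_abs_deriv_mul measurableSet_Ioi
    (f := fun r : ℝ => r ^ 2 / v) (f' := fun r => 2 * r / v)
    (fun r _ => (((hasDerivAt_pow 2 r).div_const v).congr_deriv (by simp)).hasDerivWithinAt)]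
  · rw [himg]
    refine setLIntegral_congr_fun measurableSet_Ioi fun r hr => ?_
    have hr0 : 0 < r := hr
    simp only
    rw [abs_of_pos (by positivity), show v * (r ^ 2 / v) = r ^ 2 by field_simp,
      Real.sqrt_sq hr0.le, unifAngle, lintegral_smul_measure, smul_eq_mul]
  · intro a ha b hb hab
    have ha0 : 0 < a := ha
    have hb0 : 0 < b := hb
    simp only at hab
    rw [div_left_inj' hv.ne'] at hab
    exact (pow_left_inj₀ ha0.le hb0.le two_ne_zero).mp hab

lemma gaussianPDF_mul_gaussianPDF_polar {v : ℝ} (hv : 0 < v) (r θ : ℝ) :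
    gaussianPDF 0 (v / 2).toNNReal (r * Real.cos θ) *
      gaussianPDF 0 (v / 2).toNNReal (r * Real.sin θ) =
    ENNReal.ofReal (2 / v) * (ENNReal.ofReal (Real.exp (-(r ^ 2 / v))) *
      ENNReal.ofReal (2 * Real.pi)⁻¹) := by
  have hpi := Real.pi_pos
  rw [gaussianPDF, gaussianPDF, ← ENNReal.ofReal_mul (gaussianPDFReal_nonneg _ _ _),
    ← ENNReal.ofReal_mul (by positivity), ← ENNReal.ofReal_mul (by positivity)]
  congr 1
  rw [gaussianPDFReal, gaussianPDFReal, Real.coe_toNNReal _ (by positivity : 0 ≤ v / 2),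
    show 2 * Real.pi * (v / 2) = Real.pi * v by ring]
  have h1 : (Real.sqrt (Real.pi * v))⁻¹ * (Real.sqrt (Real.pi * v))⁻¹ = (Real.pi * v)⁻¹ := by
    rw [← mul_inv, Real.mul_self_sqrt (by positivity)]
  have h2 : Real.exp (-(r * Real.cos θ - 0) ^ 2 / (2 * (v / 2))) *
      Real.exp (-(r * Real.sin θ - 0) ^ 2 / (2 * (v / 2))) = Real.exp (-(r ^ 2 / v)) := by
    rw [← Real.exp_add]
    congr 1
    field_simp
    linear_combination (-r ^ 2) * Real.sin_sq_add_cos_sq θ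
  rw [mul_mul_mul_comm, h1, h2]
  field_simp

/-- This is the Box–Muller correspondence: the product density is rotation invariant, and the
Jacobian `r` turns its radial part into an exponential law for `r² / v`. -/
lemma map_gaussianReal_prod_eq_circGauss {v : ℝ} (hv : 0 < v) :
    ((gaussianReal 0 (v / 2).toNNReal).prod (gaussianReal 0 (v / 2).toNNReal)).map
      Complex.measurableEquivRealProd.symm = circGauss v := by
  refine Measure.ext_of_lintegral _ fun f hf => ?_
  have hs : (v / 2).toNNReal ≠ 0 := by
    rw [Ne, Real.toNNReal_eq_zero, not_le]; positivity
  have hm : Measurable fun z : ℝ × ℝ => gaussianPDF 0 (v / 2).toNNReal z.1 *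
      gaussianPDF 0 (v / 2).toNNReal z.2 := by fun_prop
  have hfm : Measurable fun z : ℝ × ℝ => f (Complex.measurableEquivRealProd.symm z) :=
    hf.comp Complex.measurableEquivRealProd.symm.measurable
  rw [lintegral_map hf Complex.measurableEquivRealProd.symm.measurable,
    gaussianReal_of_var_ne_zero _ hs, prod_withDensity (by fun_prop) (by fun_prop),
    lintegral_withDensity_eq_lintegral_mul _ hm hfm, ← Measure.volume_eq_prod,
    ← lintegral_comp_polarCoord_symm, polarCoord_target, Measure.volume_eq_prod,
    ← Measure.prod_restrict, lintegral_prod, lintegral_circGauss hv hf]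
  · refine setLIntegral_congr_fun measurableSet_Ioi fun r hr => ?_
    have hr0 : 0 < r := hr
    have hc : ∀ θ : ℝ, Complex.measurableEquivRealProd.symm (r * Real.cos θ, r * Real.sin θ) =
        circleMap 0 r θ := fun θ => by
      apply Complex.ext <;>
      simp [circleMap, Complex.measurableEquivRealProd, Complex.exp_ofReal_mul_I_re,
        Complex.exp_ofReal_mul_I_im]
    simp only [polarCoord_symm_apply, Pi.mul_apply, smul_eq_mul, hc,
      gaussianPDF_mul_gaussianPDF_polar hv]
    have hfc : Measurable fun θ => f (circleMap 0 r θ) := hf.comp (by fun_prop)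
    rw [lintegral_const_mul _ (by fun_prop), lintegral_const_mul _ (by fun_prop)]
    rw [show 2 * r / v = r * (2 / v) by ring, ENNReal.ofReal_mul hr0.le]
    ring
  · have h1 : Measurable fun p : ℝ × ℝ => (polarCoord.symm p) := by
      simp only [polarCoord_symm_apply]
      fun_prop
    exact (Measurable.mul (by fun_prop) ((hm.mul hfm).comp h1)).aemeasurable

section

variable {Ω : Type*} [MeasurableSpace Ω] {P : Measure Ω}

lemma HasGaussianLaw.integrable_mul {X Y : Ω → ℂ} (hX : HasGaussianLaw X P)
    (hY : HasGaussianLaw Y P) : Integrable (fun ω => X ω * Y ω) P :=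
  hX.memLp_two.integrable_mul hY.memLp_two

/-- A centred complex Gaussian variable with vanishing pseudo-variance is circularly symmetric. -/
lemma HasGaussianLaw.map_eq_circGauss {D : Ω → ℂ} {v : ℝ} (hv : 0 < v)
    (hD : HasGaussianLaw D P) (h0 : ∫ ω, D ω ∂P = 0) (h1 : ∫ ω, D ω * D ω ∂P = 0)
    (h2 : ∫ ω, ‖D ω‖ ^ 2 ∂P = v) : P.map D = circGauss v := by
  have := hD.isProbabilityMeasure
  have hpair : HasGaussianLaw (fun ω => ((D ω).re, (D ω).im)) P :=
    hD.map_fun Complex.equivRealProdCLM.toContinuousLinearMap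
  have hre := hpair.fst
  have him := hpair.snd
  have hDi := hD.integrable
  have hre0 : ∫ ω, (D ω).re ∂P = 0 := by
    have := integral_re hDi
    simp only [RCLike.re_to_complex] at this
    rw [this, h0]; rfl
  have him0 : ∫ ω, (D ω).im ∂P = 0 := by
    have := integral_im hDi
    simp only [RCLike.im_to_complex] at this
    rw [this, h0]; rfl
  have hDD := HasGaussianLaw.integrable_mul hD hD
  have hA : Integrable (fun ω => (D ω).re * (D ω).re) P :=
    hre.memLp_two.integrable_mul hre.memLp_two
  have hB : Integrable (fun ω => (D ω).im * (D ω).im) P :=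
    him.memLp_two.integrable_mul him.memLp_two
  have hAB : Integrable (fun ω => (D ω).re * (D ω).im) P :=
    hre.memLp_two.integrable_mul him.memLp_two
  -- The real part of `E[D²] = 0` equates the two variances, which are then `v / 2` each; the
  -- imaginary part, used below, decorrelates the coordinates.
  have hdiff : ∫ ω, (D ω).re * (D ω).re ∂P - ∫ ω, (D ω).im * (D ω).im ∂P = 0 := by
    rw [← integral_sub hA hB]
    have := integral_re hDD
    simp only [RCLike.re_to_complex, Complex.mul_re] at this
    rw [this, h1]; rfl
  have hsum : ∫ ω, (D ω).re * (D ω).re ∂P + ∫ ω, (D ω).im * (D ω).im ∂P = v := by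
    rw [← integral_add hA hB, ← h2]
    congr 1; funext ω
    rw [← Complex.normSq_eq_norm_sq, Complex.normSq_apply]
  have hprod : ∫ ω, (D ω).re * (D ω).im ∂P = 0 := by
    have := integral_im hDD
    simp only [RCLike.im_to_complex, Complex.mul_im] at this
    rw [h1, show (fun ω => (D ω).re * (D ω).im + (D ω).im * (D ω).re) =
      fun ω => 2 * ((D ω).re * (D ω).im) by funext ω; ring, integral_const_mul] at this
    simpa using this
  have hind : IndepFun (fun ω => (D ω).re) (fun ω => (D ω).im) P := by
    refine hpair.indepFun_of_covariance_eq_zero ?_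
    rw [covariance_eq_sub hre.memLp_two him.memLp_two, hre0, him0]
    simpa using hprod
  have hlre : P.map (fun ω => (D ω).re) = gaussianReal 0 (v / 2).toNNReal := by
    rw [hre.map_eq_gaussianReal, variance_eq_sub hre.memLp_two, hre0]
    congr 2
    simp only [Pi.pow_apply, pow_two]
    linarith
  have hlim : P.map (fun ω => (D ω).im) = gaussianReal 0 (v / 2).toNNReal := by
    rw [him.map_eq_gaussianReal, variance_eq_sub him.memLp_two, him0]
    congr 2
    simp only [Pi.pow_apply, pow_two]
    linarith
  rw [← map_gaussianReal_prod_eq_circGauss hv]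
  nth_rewrite 1 [← hlre]
  rw [← hlim, ← (indepFun_iff_map_prod_eq_prod_map_map hre.aemeasurable him.aemeasurable).mp hind,
    AEMeasurable.map_map_of_aemeasurable Complex.measurableEquivRealProd.symm.measurable.aemeasurable
      hpair.aemeasurable]
  congr 1

end

/-- Jensen's formula for a linear function: the circle average of `log |z - c|` sees only the radius
and whether `c` lies outside the disc. Squaring the moduli doubles both terms. -/
lemma integral_log_norm_add_circleMap_sq {s : ℝ} (hs : 0 < s) (a : ℂ) :
    ∫ θ, Real.log (‖a + circleMap 0 (Real.sqrt s) θ‖ ^ 2) ∂unifAngle =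
      Real.log s + Real.posLog (‖a‖ ^ 2 / s) := by
  have hR : 0 < Real.sqrt s := Real.sqrt_pos.mpr hs
  have h := circleAverage_log_norm_sub_const_eq_log_radius_add_posLog (c := 0) (a := -a) hR.ne'
  rw [← integral_unifAngle_circleMap] at h
  have h2 : ∀ θ, Real.log (‖a + circleMap 0 (Real.sqrt s) θ‖ ^ 2) =
      2 * Real.log ‖circleMap 0 (Real.sqrt s) θ - -a‖ := fun θ => by
    rw [Real.log_pow, sub_neg_eq_add, add_comm]
    norm_num
  simp_rw [h2]
  have h3 : Real.log s = 2 * Real.log (Real.sqrt s) := by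
    rw [Real.log_sqrt hs.le]; ring
  have h4 : ‖a‖ ^ 2 / s = ((Real.sqrt s)⁻¹ * ‖(0 : ℂ) - -a‖) ^ 2 := by
    rw [mul_pow, inv_pow, Real.sq_sqrt hs.le]
    simp
    ring
  rw [integral_const_mul, h, mul_add, h3, h4, Real.posLog_pow]
  norm_num

/-! ### Joint logarithmic moment of two correlated Gaussians -/

section

variable {Ω : Type*} [MeasurableSpace Ω] {P : Measure Ω} {X : Ω → ℝ}

lemma memLp_comp_of_map_eq_stdExp (hX : AEMeasurable X P) (hl : P.map X = stdExp)
    {f : ℝ → ℝ} (hf : MemLp f 2 stdExp) : MemLp (fun ω => f (X ω)) 2 P := by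
  rw [← hl] at hf
  exact hf.comp_of_map hX

lemma integral_comp_of_map_eq_stdExp (hX : AEMeasurable X P) (hl : P.map X = stdExp)
    {f : ℝ → ℝ} (hf : Measurable f) : ∫ ω, f (X ω) ∂P = ∫ x, f x ∂stdExp := by
  rw [← hl, integral_map hX hf.aestronglyMeasurable]

lemma map_norm_sq_eq_stdExp {Z : Ω → ℂ} (hZ : AEMeasurable Z P) (hl : P.map Z = circGauss 1) :
    P.map (fun ω => ‖Z ω‖ ^ 2) = stdExp := by
  rw [← map_norm_sq_circGauss_one, ← hl, AEMeasurable.map_map_of_aemeasurable (by fun_prop) hZ]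
  rfl

/-- The joint logarithmic moment of the powers of two correlated circularly symmetric complex
Gaussian variables of unit power. -/
lemma integral_log_norm_sq_mul_log_norm_sq {Z D : Ω → ℂ} {b : ℂ} {p : ℝ} (hp : p = ‖b‖ ^ 2)
    (hp1 : p < 1) (hZ : AEMeasurable Z P) (hD : AEMeasurable D P)
    (hZl : P.map Z = circGauss 1) (hDl : P.map D = circGauss (1 - p))
    (hWl : P.map (fun ω => b * Z ω + D ω) = circGauss 1) (hind : IndepFun Z D P) :
    ∫ ω, Real.log (‖Z ω‖ ^ 2) * Real.log (‖b * Z ω + D ω‖ ^ 2) ∂P =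
      Real.eulerMascheroniConstant ^ 2 + dilog p := by
  have hp0 : 0 ≤ p := by rw [hp]; positivity
  have hq : 0 < 1 - p := by linarith
  have hPZ : IsProbabilityMeasure P := by
    have : IsProbabilityMeasure (P.map Z) := by rw [hZl]; infer_instance
    exact P.isProbabilityMeasure_of_map Z
  have hW : AEMeasurable (fun ω => b * Z ω + D ω) P := by fun_prop
  have hX : AEMeasurable (fun ω => ‖Z ω‖ ^ 2) P := by fun_prop
  have hXl := map_norm_sq_eq_stdExp hZ hZl
  have hY : AEMeasurable (fun ω => ‖b * Z ω + D ω‖ ^ 2) P := by fun_prop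
  have hYl := map_norm_sq_eq_stdExp hW hWl
  have hint : Integrable
      (fun ω => Real.log (‖Z ω‖ ^ 2) * Real.log (‖b * Z ω + D ω‖ ^ 2)) P :=
    (memLp_comp_of_map_eq_stdExp hX hXl memLp_log_stdExp).integrable_mul
      (memLp_comp_of_map_eq_stdExp hY hYl memLp_log_stdExp)
  set F : ℂ × ℂ → ℝ := fun z => Real.log (‖z.1‖ ^ 2) * Real.log (‖b * z.1 + z.2‖ ^ 2) with hF
  have hFm : Measurable F := by fun_prop
  have hjoint : P.map (fun ω => (Z ω, D ω)) = (circGauss 1).prod (circGauss (1 - p)) := by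
    rw [(indepFun_iff_map_prod_eq_prod_map_map hZ hD).mp hind, hZl, hDl]
  have hFi : Integrable F ((circGauss 1).prod (circGauss (1 - p))) := by
    rw [← hjoint, integrable_map_measure hFm.aestronglyMeasurable (hZ.prodMk hD)]
    exact hint
  have h1 : ∫ ω, Real.log (‖Z ω‖ ^ 2) * Real.log (‖b * Z ω + D ω‖ ^ 2) ∂P =
      ∫ z, F z ∂((circGauss 1).prod (circGauss (1 - p))) := by
    rw [← hjoint, integral_map (hZ.prodMk hD) hFm.aestronglyMeasurable]
  set G : ℝ → ℝ := fun x => Real.log x * ∫ y, (Real.log ((1 - p) * y) +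
        Real.posLog (p * x / ((1 - p) * y))) ∂stdExp with hG
  have hGm : Measurable G := by
    refine Real.measurable_log.mul ?_
    have : StronglyMeasurable (Function.uncurry fun x y : ℝ => Real.log ((1 - p) * y) +
        Real.posLog (p * x / ((1 - p) * y))) := by
      refine Measurable.stronglyMeasurable (Measurable.add ?_
        (Real.continuous_posLog.measurable.comp ?_))
      · exact (by fun_prop : Measurable fun z : ℝ × ℝ => Real.log ((1 - p) * z.2))
      · exact (by fun_prop : Measurable fun z : ℝ × ℝ => p * z.1 / ((1 - p) * z.2))
    exact this.integral_prod_right.measurable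
  -- Averaging over the phase of `d` first leaves a function of `‖z‖²` alone, so the outer integral
  -- descends to the exponential law.
  have h2 : ∀ᵐ z ∂circGauss 1, ∫ d, F (z, d) ∂circGauss (1 - p) = G (‖z‖ ^ 2) := by
    filter_upwards [hFi.prod_right_ae] with z hz
    have hm := measurable_circGauss_map (1 - p)
    have hFz : Measurable fun d => F (z, d) := hFm.comp measurable_prodMk_left
    rw [circGauss, integrable_map_measure hFz.aestronglyMeasurable hm.aemeasurable,
      Function.comp_def] at hz
    rw [circGauss, integral_map hm.aemeasurable hFz.aestronglyMeasurable, integral_prod _ hz, hG]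
    simp only [hF]
    rw [← integral_const_mul]
    refine integral_congr_ae ?_
    filter_upwards [ae_pos_stdExp] with y hy
    rw [integral_const_mul, integral_log_norm_add_circleMap_sq (mul_pos hq hy), norm_mul, mul_pow,
      ← hp]
  rw [h1, integral_prod _ hFi, integral_congr_ae h2,
    ← integral_map (μ := circGauss 1) (φ := fun z : ℂ => ‖z‖ ^ 2) (by fun_prop)
      hGm.aestronglyMeasurable, map_norm_sq_circGauss_one,
    integral_log_mul_integral_log_add_posLog hp0 hp1]

end

/-! ### Independence of jointly Gaussian complex variables -/

section

variable {Ω : Type*} [MeasurableSpace Ω] {P : Measure Ω}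

/-- Jointly Gaussian centred complex variables with vanishing cross-covariance and
cross-pseudo-covariance are independent. -/
lemma HasGaussianLaw.indepFun_of_integral_mul_eq_zero {Z D : Ω → ℂ}
    (hZD : HasGaussianLaw (fun ω => (Z ω, D ω)) P) (hZ0 : ∫ ω, Z ω ∂P = 0)
    (h1 : ∫ ω, Z ω * D ω ∂P = 0) (h2 : ∫ ω, Z ω * (starRingEnd ℂ) (D ω) ∂P = 0) :
    IndepFun Z D P := by
  have := hZD.isProbabilityMeasure
  have hZ := hZD.fst
  have hD := hZD.snd
  have hDc : HasGaussianLaw (fun ω => (starRingEnd ℂ) (D ω)) P :=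
    hD.map_fun Complex.conjCLE.toContinuousLinearMap
  refine hZD.indepFun_of_covariance_inner fun x y => ?_
  have hx : HasGaussianLaw (fun ω => inner ℝ x (Z ω)) P := hZ.map_fun (innerSL ℝ x)
  have hy : HasGaussianLaw (fun ω => inner ℝ y (D ω)) P := hD.map_fun (innerSL ℝ y)
  have hx0 : ∫ ω, inner ℝ x (Z ω) ∂P = 0 := by
    have := (innerSL ℝ x).integral_comp_comm hZ.integrable
    simp only [innerSL_apply_apply] at this
    rw [this, hZ0, inner_zero_right]
  rw [covariance_eq_sub hx.memLp_two hy.memLp_two, hx0, zero_mul, sub_zero]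
  have hi1 : Integrable (fun ω => ((starRingEnd ℂ) x * (starRingEnd ℂ) y) * (Z ω * D ω)) P :=
    (HasGaussianLaw.integrable_mul hZ hD).const_mul _
  have hi2 : Integrable (fun ω => ((starRingEnd ℂ) x * y) * (Z ω * (starRingEnd ℂ) (D ω))) P :=
    (HasGaussianLaw.integrable_mul hZ hDc).const_mul _
  have h3 : ∫ ω, (((starRingEnd ℂ) x * (starRingEnd ℂ) y) * (Z ω * D ω) +
      ((starRingEnd ℂ) x * y) * (Z ω * (starRingEnd ℂ) (D ω))) ∂P = 0 := by
    rw [integral_add hi1 hi2, integral_const_mul, integral_const_mul, h1, h2]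
    simp
  have h4 := integral_re (hi1.add hi2)
  simp only [Pi.add_apply, h3, RCLike.re_to_complex] at h4
  -- This is `2 Re A Re B = Re (A B + A conj B)` with `A = conj x * Z` and `B = conj y * D`: both
  -- complex moments are needed to kill every real covariance.
  have h5 : ∀ ω, (((starRingEnd ℂ) x * (starRingEnd ℂ) y) * (Z ω * D ω) +
      ((starRingEnd ℂ) x * y) * (Z ω * (starRingEnd ℂ) (D ω))).re =
      2 * (inner ℝ x (Z ω) * inner ℝ y (D ω)) := fun ω => by
    simp only [Complex.inner, Complex.add_re, Complex.mul_re, Complex.mul_im, Complex.conj_re,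
      Complex.conj_im]
    ring
  simp_rw [h5] at h4
  rw [integral_const_mul] at h4
  simpa using h4

/-! ### High-SNR expansion of the mutual information -/

/-- With `u = w⁴`, this is `1 + w⁴ ≤ (1 + w)⁴ ≤ e^(4w)`. -/
lemma log_one_add_le_four_mul_rpow {u : ℝ} (hu : 0 ≤ u) :
    Real.log (1 + u) ≤ 4 * u ^ (1 / 4 : ℝ) := by
  set w := u ^ (1 / 4 : ℝ) with hw
  have hw0 : 0 ≤ w := Real.rpow_nonneg hu _
  have huw : u = w ^ 4 := by
    rw [hw, ← Real.rpow_natCast, ← Real.rpow_mul hu]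
    norm_num
  rw [Real.log_le_iff_le_exp (by positivity)]
  calc 1 + u ≤ (w + 1) ^ 4 := by rw [huw]; nlinarith [pow_nonneg hw0 2, pow_nonneg hw0 3]
    _ ≤ Real.exp w ^ 4 := by gcongr; exact Real.add_one_le_exp w
    _ = Real.exp (4 * w) := by rw [← Real.exp_nat_mul]; norm_num

lemma abs_log_one_add_mul_sub_le {η x : ℝ} (hη : 0 < η) (hx : 0 < x) :
    |Real.log (1 + η * x) - (Real.log η + Real.log x)| ≤
      4 * η ^ (-(1 / 4) : ℝ) * x ^ (-(1 / 4) : ℝ) := by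
  have hηx : 0 < η * x := mul_pos hη hx
  have h1 : Real.log (1 + η * x) - (Real.log η + Real.log x) = Real.log (1 + (η * x)⁻¹) := by
    rw [← Real.log_mul hη.ne' hx.ne', ← Real.log_div (by positivity) hηx.ne']
    congr 1
    field_simp
    ring
  have h2 : 0 < (η * x)⁻¹ := inv_pos.mpr hηx
  rw [h1, abs_of_nonneg (Real.log_nonneg (by linarith))]
  refine (log_one_add_le_four_mul_rpow h2.le).trans (le_of_eq ?_)
  rw [Real.inv_rpow hηx.le, ← Real.rpow_neg hηx.le, Real.mul_rpow hη.le hx.le]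
  ring

lemma tendsto_rpow_neg_fourth_mul_log :
    Tendsto (fun η : ℝ => η ^ (-(1 / 4) : ℝ) * (1 + Real.log η)) atTop (𝓝 0) := by
  have h1 := tendsto_rpow_neg_atTop (y := 1 / 4) (by norm_num)
  have h2 := (isLittleO_log_rpow_atTop (r := 1 / 4) (by norm_num)).tendsto_div_nhds_zero
  have h3 := h1.add h2
  rw [add_zero] at h3
  refine h3.congr' ?_
  filter_upwards [eventually_gt_atTop 0] with η hη
  rw [Real.rpow_neg hη.le]
  ring

lemma memLp_log_one_add_mul_stdExp {η : ℝ} (hη : 0 < η) :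
    MemLp (fun x => Real.log (1 + η * x)) 2 stdExp := by
  refine (memLp_id_stdExp.const_mul η).mono
    (by fun_prop : Measurable fun x => Real.log (1 + η * x)).aestronglyMeasurable ?_
  filter_upwards [ae_pos_stdExp] with x hx
  have h0 : 0 < η * x := mul_pos hη hx
  rw [Real.norm_eq_abs, Real.norm_eq_abs, abs_of_pos h0,
    abs_of_nonneg (Real.log_nonneg (by linarith))]
  linarith [Real.log_le_sub_one_of_pos (by linarith : 0 < 1 + η * x)]

lemma abs_integral_log_one_add_mul_sub_le {η : ℝ} (hη : 0 < η) :
    |∫ x, Real.log (1 + η * x) ∂stdExp - (Real.log η - Real.eulerMascheroniConstant)| ≤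
      η ^ (-(1 / 4) : ℝ) * ∫ x, 4 * x ^ (-(1 / 4) : ℝ) ∂stdExp := by
  have hi := (memLp_log_one_add_mul_stdExp hη).integrable (by norm_num)
  have hi2 : Integrable (fun x => Real.log η + Real.log x) stdExp :=
    (integrable_const _).add integrable_log_stdExp
  have h1 : ∫ x, Real.log (1 + η * x) ∂stdExp - (Real.log η - Real.eulerMascheroniConstant) =
      ∫ x, (Real.log (1 + η * x) - (Real.log η + Real.log x)) ∂stdExp := by
    rw [integral_sub hi hi2, integral_add (integrable_const _) integrable_log_stdExp,
      integral_log_stdExp]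
    simp
    ring
  rw [h1, ← integral_const_mul]
  have hb : Integrable (fun x : ℝ => η ^ (-(1 / 4) : ℝ) * (4 * x ^ (-(1 / 4) : ℝ))) stdExp :=
    ((integrable_rpow_stdExp (by norm_num)).const_mul 4).const_mul _
  rw [← Real.norm_eq_abs]
  refine norm_integral_le_of_norm_le hb ?_
  filter_upwards [ae_pos_stdExp] with x hx
  refine (abs_log_one_add_mul_sub_le hη hx).trans (le_of_eq (by ring))

/-- The weight is essential: the mean is later squared, which multiplies its error by a factor of
order `log η`. -/
lemma tendsto_mul_integral_log_one_add_mul_sub :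
    Tendsto (fun η : ℝ => (1 + Real.log η) * (∫ x, Real.log (1 + η * x) ∂stdExp -
      (Real.log η - Real.eulerMascheroniConstant))) atTop (𝓝 0) := by
  have h := tendsto_rpow_neg_fourth_mul_log.mul_const (∫ x, 4 * x ^ (-(1 / 4) : ℝ) ∂stdExp)
  rw [zero_mul] at h
  refine squeeze_zero_norm' ?_ h
  filter_upwards [eventually_ge_atTop 1] with η hη
  have hl : 0 ≤ 1 + Real.log η := by linarith [Real.log_nonneg hη]
  rw [norm_mul, Real.norm_eq_abs, Real.norm_eq_abs, abs_of_nonneg hl]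
  calc _ ≤ (1 + Real.log η) * (η ^ (-(1 / 4) : ℝ) * ∫ x, 4 * x ^ (-(1 / 4) : ℝ) ∂stdExp) := by
        gcongr
        exact abs_integral_log_one_add_mul_sub_le (by linarith)
    _ = _ := by ring

/-- The integrable envelope of the error in the joint expansion. -/
noncomputable def logProdEnvelope (x y : ℝ) : ℝ :=
  4 * ((1 + |Real.log x|) * y ^ (-(1 / 4) : ℝ)) +
    4 * ((1 + |Real.log y|) * x ^ (-(1 / 4) : ℝ)) +
    16 * (x ^ (-(1 / 4) : ℝ) * y ^ (-(1 / 4) : ℝ))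

/-- Expand `ab - AB = A(b - B) + B(a - A) + (a - A)(b - B)`; `δ ≤ 1` absorbs the quadratic term into
a bound linear in `δ`. -/
lemma abs_mul_sub_mul_le {a b A B l u v δ VX VY : ℝ} (hl : 0 ≤ l) (hu : 0 ≤ u) (hv : 0 ≤ v)
    (hδ0 : 0 ≤ δ) (hδ1 : δ ≤ 1) (hVX : 0 ≤ VX) (hVY : 0 ≤ VY)
    (ha : |a - A| ≤ 4 * δ * VX) (hb : |b - B| ≤ 4 * δ * VY)
    (hA : |A| ≤ (1 + l) * (1 + u)) (hB : |B| ≤ (1 + l) * (1 + v)) :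
    |a * b - A * B| ≤ δ * (1 + l) *
      (4 * ((1 + u) * VY) + 4 * ((1 + v) * VX) + 16 * (VX * VY)) := by
  have t1 : |A * (b - B)| ≤ (1 + l) * (1 + u) * (4 * δ * VY) := by
    rw [abs_mul]; gcongr
  have t2 : |B * (a - A)| ≤ (1 + l) * (1 + v) * (4 * δ * VX) := by
    rw [abs_mul]; gcongr
  have t3 : |(a - A) * (b - B)| ≤ (1 + l) * (16 * δ * (VX * VY)) := by
    calc |(a - A) * (b - B)| ≤ (4 * δ * VX) * (4 * δ * VY) := by rw [abs_mul]; gcongr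
      _ = 1 * (16 * δ * (VX * VY)) * δ := by ring
      _ ≤ (1 + l) * (16 * δ * (VX * VY)) * 1 := by
        gcongr
        linarith
      _ = _ := by ring
  calc |a * b - A * B| = |A * (b - B) + B * (a - A) + (a - A) * (b - B)| := by
        congr 1; ring
    _ ≤ |A * (b - B)| + |B * (a - A)| + |(a - A) * (b - B)| := abs_add_three _ _ _
    _ ≤ _ := add_le_add (add_le_add t1 t2) t3
    _ = _ := by ring

lemma abs_log_add_log_le {η x : ℝ} (hη : 1 ≤ η) :
    |Real.log η + Real.log x| ≤ (1 + Real.log η) * (1 + |Real.log x|) := by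
  have hl : 0 ≤ Real.log η := Real.log_nonneg hη
  refine (abs_add_le _ _).trans ?_
  rw [abs_of_nonneg hl]
  nlinarith [abs_nonneg (Real.log x), mul_nonneg hl (abs_nonneg (Real.log x))]

lemma abs_log_mul_log_sub_le {η x y : ℝ} (hη : 1 ≤ η) (hx : 0 < x) (hy : 0 < y) :
    |Real.log (1 + η * x) * Real.log (1 + η * y) -
        (Real.log η + Real.log x) * (Real.log η + Real.log y)| ≤
      η ^ (-(1 / 4) : ℝ) * (1 + Real.log η) * logProdEnvelope x y := by
  have hη0 : 0 < η := by linarith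
  exact abs_mul_sub_mul_le (Real.log_nonneg hη) (abs_nonneg _) (abs_nonneg _)
    (Real.rpow_nonneg hη0.le _) (Real.rpow_le_one_of_one_le_of_nonpos hη (by norm_num))
    (Real.rpow_nonneg hx.le _) (Real.rpow_nonneg hy.le _) (abs_log_one_add_mul_sub_le hη0 hx)
    (abs_log_one_add_mul_sub_le hη0 hy) (abs_log_add_log_le hη) (abs_log_add_log_le hη)

lemma memLp_log_one_add_mul {X : Ω → ℝ} (hX : AEMeasurable X P) (hXl : P.map X = stdExp) {η : ℝ}
    (hη : 0 < η) : MemLp (fun ω => Real.log (1 + η * X ω)) 2 P :=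
  memLp_comp_of_map_eq_stdExp (f := fun x => Real.log (1 + η * x)) hX hXl
    (memLp_log_one_add_mul_stdExp hη)

variable {X Y : Ω → ℝ} [IsProbabilityMeasure P]

lemma integrable_logProdEnvelope (hX : AEMeasurable X P) (hY : AEMeasurable Y P)
    (hXl : P.map X = stdExp) (hYl : P.map Y = stdExp) :
    Integrable (fun ω => logProdEnvelope (X ω) (Y ω)) P := by
  have hlX := memLp_comp_of_map_eq_stdExp hX hXl memLp_log_stdExp
  have hlY := memLp_comp_of_map_eq_stdExp hY hYl memLp_log_stdExp
  have hvX := memLp_comp_of_map_eq_stdExp hX hXl memLp_rpow_neg_fourth_stdExp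
  have hvY := memLp_comp_of_map_eq_stdExp hY hYl memLp_rpow_neg_fourth_stdExp
  have h1 : Integrable (fun ω => (1 + |Real.log (X ω)|) * Y ω ^ (-(1 / 4) : ℝ)) P :=
    ((memLp_const (1 : ℝ)).add hlX.abs).integrable_mul hvY
  have h2 : Integrable (fun ω => (1 + |Real.log (Y ω)|) * X ω ^ (-(1 / 4) : ℝ)) P :=
    ((memLp_const (1 : ℝ)).add hlY.abs).integrable_mul hvX
  have h3 : Integrable (fun ω => X ω ^ (-(1 / 4) : ℝ) * Y ω ^ (-(1 / 4) : ℝ)) P :=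
    hvX.integrable_mul hvY
  exact ((h1.const_mul 4).add (h2.const_mul 4)).add (h3.const_mul 16)

lemma integral_log_add_log_mul (hX : AEMeasurable X P) (hY : AEMeasurable Y P)
    (hXl : P.map X = stdExp) (hYl : P.map Y = stdExp) (c : ℝ) :
    ∫ ω, (c + Real.log (X ω)) * (c + Real.log (Y ω)) ∂P =
      c ^ 2 - 2 * Real.eulerMascheroniConstant * c +
        ∫ ω, Real.log (X ω) * Real.log (Y ω) ∂P := by
  have hlX := memLp_comp_of_map_eq_stdExp hX hXl memLp_log_stdExp
  have hlY := memLp_comp_of_map_eq_stdExp hY hYl memLp_log_stdExp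
  have hXi := (hlX.integrable (by norm_num)).const_mul c
  have hYi := (hlY.integrable (by norm_num)).const_mul c
  have hXY : Integrable (fun ω => Real.log (X ω) * Real.log (Y ω)) P := hlX.integrable_mul hlY
  have e1 : ∫ ω, Real.log (X ω) ∂P = -Real.eulerMascheroniConstant := by
    rw [integral_comp_of_map_eq_stdExp hX hXl Real.measurable_log, integral_log_stdExp]
  have e2 : ∫ ω, Real.log (Y ω) ∂P = -Real.eulerMascheroniConstant := by
    rw [integral_comp_of_map_eq_stdExp hY hYl Real.measurable_log, integral_log_stdExp]
  calc _ = ∫ ω, ((c ^ 2 + c * Real.log (X ω)) +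
        (c * Real.log (Y ω) + Real.log (X ω) * Real.log (Y ω))) ∂P := by
        congr 1; funext ω; ring
    _ = (∫ ω, (c ^ 2 + c * Real.log (X ω)) ∂P) +
        ∫ ω, (c * Real.log (Y ω) + Real.log (X ω) * Real.log (Y ω)) ∂P :=
        integral_add ((integrable_const _).add hXi) (hYi.add hXY)
    _ = _ := by
        rw [integral_add (integrable_const _) hXi, integral_add hYi hXY, integral_const_mul,
          integral_const_mul, e1, e2]
        simp
        ring

lemma memLp_const_add_log (hX : AEMeasurable X P) (hXl : P.map X = stdExp) (c : ℝ) :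
    MemLp (fun ω => c + Real.log (X ω)) 2 P :=
  (memLp_const c).add (memLp_comp_of_map_eq_stdExp (f := Real.log) hX hXl memLp_log_stdExp)

lemma abs_integral_log_one_add_mul_mul_sub_le (hX : AEMeasurable X P) (hY : AEMeasurable Y P)
    (hXl : P.map X = stdExp) (hYl : P.map Y = stdExp) {η : ℝ} (hη : 1 ≤ η) :
    |∫ ω, Real.log (1 + η * X ω) * Real.log (1 + η * Y ω) ∂P -
      (Real.log η ^ 2 - 2 * Real.eulerMascheroniConstant * Real.log η +
        ∫ ω, Real.log (X ω) * Real.log (Y ω) ∂P)| ≤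
      η ^ (-(1 / 4) : ℝ) * (1 + Real.log η) * ∫ ω, logProdEnvelope (X ω) (Y ω) ∂P := by
  have hη0 : 0 < η := by linarith
  have hXpos : ∀ᵐ ω ∂P, 0 < X ω := ae_of_ae_map hX (by rw [hXl]; exact ae_pos_stdExp)
  have hYpos : ∀ᵐ ω ∂P, 0 < Y ω := ae_of_ae_map hY (by rw [hYl]; exact ae_pos_stdExp)
  have hi1 : Integrable (fun ω => Real.log (1 + η * X ω) * Real.log (1 + η * Y ω)) P :=
    (memLp_log_one_add_mul hX hXl hη0).integrable_mul (memLp_log_one_add_mul hY hYl hη0)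
  have hi2 : Integrable
      (fun ω => (Real.log η + Real.log (X ω)) * (Real.log η + Real.log (Y ω))) P :=
    (memLp_const_add_log hX hXl _).integrable_mul (memLp_const_add_log hY hYl _)
  have hb := (integrable_logProdEnvelope hX hY hXl hYl).const_mul
    (η ^ (-(1 / 4) : ℝ) * (1 + Real.log η))
  rw [← integral_log_add_log_mul hX hY hXl hYl, ← integral_sub hi1 hi2, ← integral_const_mul,
    ← Real.norm_eq_abs]
  refine norm_integral_le_of_norm_le hb ?_
  filter_upwards [hXpos, hYpos] with ω hx hy
  exact abs_log_mul_log_sub_le hη hx hy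

/-- The joint moment of the logarithmic rates of two standard exponential powers, for large SNR. -/
lemma tendsto_integral_log_one_add_mul_mul (hX : AEMeasurable X P) (hY : AEMeasurable Y P)
    (hXl : P.map X = stdExp) (hYl : P.map Y = stdExp) :
    Tendsto (fun η : ℝ => ∫ ω, Real.log (1 + η * X ω) * Real.log (1 + η * Y ω) ∂P -
      (Real.log η ^ 2 - 2 * Real.eulerMascheroniConstant * Real.log η +
        ∫ ω, Real.log (X ω) * Real.log (Y ω) ∂P)) atTop (𝓝 0) := by
  have h := tendsto_rpow_neg_fourth_mul_log.mul_const (∫ ω, logProdEnvelope (X ω) (Y ω) ∂P)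
  rw [zero_mul] at h
  refine squeeze_zero_norm' ?_ h
  filter_upwards [eventually_ge_atTop 1] with η hη
  exact abs_integral_log_one_add_mul_mul_sub_le hX hY hXl hYl hη

end

/-! ### Algebra of the limits -/

lemma tendsto_add_div_sq_of_tendsto {ι : Type*} {l : Filter ι} {L a : ι → ℝ} {A : ℝ}
    (hL : Tendsto L l atTop) (ha : Tendsto (fun η => a η - (A + L η ^ 2)) l (𝓝 0)) :
    Tendsto (fun η => a η / L η ^ 2) l (𝓝 1) := by
  have hL2 : Tendsto (fun η => (L η ^ 2)⁻¹) l (𝓝 0) :=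
    ((tendsto_pow_atTop two_ne_zero).comp hL).inv_tendsto_atTop
  have h := ((ha.add_const A).mul hL2).add_const 1
  rw [mul_zero, zero_add] at h
  refine h.congr' ?_
  filter_upwards [hL.eventually_gt_atTop 0] with η hη
  have : L η ≠ 0 := ne_of_gt hη
  field_simp
  ring

/-- For the model values `a' = A + L²` and `b' = B + L²`, the expression is `(L²/b) ((a - a') - (b -
b') a'/b')`, where `L²/b` and `a'/b'` tend to `1`. -/
lemma tendsto_sq_mul_div_sub_div {ι : Type*} {l : Filter ι} {L a b : ι → ℝ} {A B : ℝ}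
    (hL : Tendsto L l atTop) (ha : Tendsto (fun η => a η - (A + L η ^ 2)) l (𝓝 0))
    (hb : Tendsto (fun η => b η - (B + L η ^ 2)) l (𝓝 0)) :
    Tendsto (fun η => L η ^ 2 * (a η / b η - (A + L η ^ 2) / (B + L η ^ 2))) l (𝓝 0) := by
  have hb1 := tendsto_add_div_sq_of_tendsto hL hb
  have hA1 := tendsto_add_div_sq_of_tendsto (a := fun η => A + L η ^ 2) (A := A) hL (by simp [tendsto_const_nhds])
  have hB1 := tendsto_add_div_sq_of_tendsto (a := fun η => B + L η ^ 2) (A := B) hL (by simp [tendsto_const_nhds])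
  have h := (hb1.inv₀ one_ne_zero).mul (ha.sub (hb.mul (hA1.div hB1 one_ne_zero)))
  rw [zero_mul, sub_zero, mul_zero] at h
  refine h.congr' ?_
  filter_upwards [hL.eventually_gt_atTop 0, hb1.eventually_ne one_ne_zero,
    hB1.eventually_ne one_ne_zero] with η hη hbη hBη
  have h0 : L η ≠ 0 := ne_of_gt hη
  have h1 : b η ≠ 0 := fun h => hbη (by simp [h])
  have h2 : B + L η ^ 2 ≠ 0 := fun h => hBη (by simp [h])
  simp only [Pi.div_apply]
  field_simp
  ring

/-- The divergent `L²` cancels: `a - m² = A + (a - A - L²) - (m - L)² - 2L(m - L)`. -/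
lemma tendsto_sub_sq_of_tendsto {ι : Type*} {l : Filter ι} {L a m : ι → ℝ} {A : ℝ}
    (ha : Tendsto (fun η => a η - (A + L η ^ 2)) l (𝓝 0))
    (hm : Tendsto (fun η => m η - L η) l (𝓝 0))
    (hLm : Tendsto (fun η => L η * (m η - L η)) l (𝓝 0)) :
    Tendsto (fun η => a η - m η ^ 2) l (𝓝 A) := by
  have h := ((ha.sub (hm.pow 2)).sub (hLm.const_mul 2)).add_const A
  norm_num at h
  refine h.congr fun η => ?_
  ring

/-! ### Rayleigh fading -/

lemma imi_eq {Ω : Type*} (h : ℝ → Ω → ℂ) (Ts η : ℝ) (l : ℤ) (ω : Ω) :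
    imi h Ts η l ω = Real.log (1 + η * ‖h (l * Ts) ω‖ ^ 2) / Real.log 2 := rfl

section

variable {Ω : Type*} [MeasurableSpace Ω] {P : Measure Ω} {h : ℝ → Ω → ℂ} {ρh : ℝ → ℂ}

lemma IsRayleighFading.map_eq_circGauss (hh : IsRayleighFading P h ρh) (t : ℝ) :
    P.map (h t) = circGauss 1 :=
  HasGaussianLaw.map_eq_circGauss one_pos (hh.gaussian.hasGaussianLaw_eval t) (hh.zero_mean t)
    (hh.circular t t) (hh.unit_power t)

lemma IsRayleighFading.map_norm_sq (hh : IsRayleighFading P h ρh) (t : ℝ) :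
    P.map (fun ω => ‖h t ω‖ ^ 2) = stdExp :=
  map_norm_sq_eq_stdExp (hh.gaussian.aemeasurable t) (hh.map_eq_circGauss t)

lemma IsRayleighFading.aemeasurable_norm_sq (hh : IsRayleighFading P h ρh) (t : ℝ) :
    AEMeasurable (fun ω => ‖h t ω‖ ^ 2) P := by
  have := hh.gaussian.aemeasurable t
  fun_prop

lemma IsRayleighFading.integral_log_mul_log (hh : IsRayleighFading P h ρh) {t τ : ℝ}
    (hlt : ‖ρh τ‖ < 1) :
    ∫ ω, Real.log (‖h t ω‖ ^ 2) * Real.log (‖h (t - τ) ω‖ ^ 2) ∂P =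
      Real.eulerMascheroniConstant ^ 2 + dilog (‖ρh τ‖ ^ 2) := by
  set Z := h t with hZdef
  set W := h (t - τ) with hWdef
  set b := (starRingEnd ℂ) (ρh τ) with hb
  -- The coefficient `b` is `E[W conj Z] = conj (ρh τ)`, so `D` is orthogonal to `Z`; vanishing
  -- pseudo-covariances make `E[Z D]` zero as well.
  set D : Ω → ℂ := fun ω => W ω - b * Z ω with hDdef
  have hZW : HasGaussianLaw (fun ω => (Z ω, W ω)) P := hh.gaussian.hasGaussianLaw_prodMk
  have hZ : HasGaussianLaw Z P := hZW.fst
  have hW : HasGaussianLaw W P := hZW.snd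
  have hZD : HasGaussianLaw (fun ω => (Z ω, D ω)) P :=
    hZW.map_fun ((ContinuousLinearMap.fst ℝ ℂ ℂ).prod
      (ContinuousLinearMap.snd ℝ ℂ ℂ - (ContinuousLinearMap.mul ℝ ℂ b).comp
        (ContinuousLinearMap.fst ℝ ℂ ℂ)))
  have hD : HasGaussianLaw D P := hZD.snd
  have hZc : HasGaussianLaw (fun ω => (starRingEnd ℂ) (Z ω)) P :=
    hZ.map_fun Complex.conjCLE.toContinuousLinearMap
  have hWc : HasGaussianLaw (fun ω => (starRingEnd ℂ) (W ω)) P :=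
    hW.map_fun Complex.conjCLE.toContinuousLinearMap
  have hDc : HasGaussianLaw (fun ω => (starRingEnd ℂ) (D ω)) P :=
    hD.map_fun Complex.conjCLE.toContinuousLinearMap
  have normSq : ∀ U : Ω → ℂ, ∫ ω, U ω * (starRingEnd ℂ) (U ω) ∂P =
      ((∫ ω, ‖U ω‖ ^ 2 ∂P : ℝ) : ℂ) := fun U => by
    rw [← integral_complex_ofReal]
    congr 1; funext ω
    rw [Complex.mul_conj, Complex.normSq_eq_norm_sq]
  have eZZ : ∫ ω, Z ω * Z ω ∂P = 0 := hh.circular t t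
  have eZW : ∫ ω, Z ω * W ω ∂P = 0 := hh.circular t (t - τ)
  have eWW : ∫ ω, W ω * W ω ∂P = 0 := hh.circular (t - τ) (t - τ)
  have eZZc : ∫ ω, Z ω * (starRingEnd ℂ) (Z ω) ∂P = 1 := by
    rw [normSq, hh.unit_power t]; simp
  have eWWc : ∫ ω, W ω * (starRingEnd ℂ) (W ω) ∂P = 1 := by
    rw [normSq, hh.unit_power (t - τ)]; simp
  have eZWc : ∫ ω, Z ω * (starRingEnd ℂ) (W ω) ∂P = ρh τ := hh.correlation t τ
  have eWZc : ∫ ω, W ω * (starRingEnd ℂ) (Z ω) ∂P = b := by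
    rw [hb, ← eZWc, ← integral_conj]
    congr 1; funext ω
    simp [mul_comm]
  have iZZ := HasGaussianLaw.integrable_mul hZ hZ
  have iZW := HasGaussianLaw.integrable_mul hZ hW
  have iZZc := HasGaussianLaw.integrable_mul hZ hZc
  have iZWc := HasGaussianLaw.integrable_mul hZ hWc
  have iWZc := HasGaussianLaw.integrable_mul hW hZc
  have iWWc := HasGaussianLaw.integrable_mul hW hWc
  have iZD := HasGaussianLaw.integrable_mul hZ hD
  have iZDc := HasGaussianLaw.integrable_mul hZ hDc
  have iWD := HasGaussianLaw.integrable_mul hW hD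
  have iWDc := HasGaussianLaw.integrable_mul hW hDc
  have iWW := HasGaussianLaw.integrable_mul hW hW
  have eD0 : ∫ ω, D ω ∂P = 0 := by
    rw [hDdef, integral_sub hW.integrable (hZ.integrable.const_mul b), integral_const_mul,
      hh.zero_mean t, hh.zero_mean (t - τ)]
    simp
  have eZD : ∫ ω, Z ω * D ω ∂P = 0 := by
    rw [show (fun ω => Z ω * D ω) = fun ω => Z ω * W ω - b * (Z ω * Z ω) by
      funext ω; simp only [hDdef]; ring, integral_sub iZW (iZZ.const_mul b), integral_const_mul,
      eZW, eZZ]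
    simp
  have eZDc : ∫ ω, Z ω * (starRingEnd ℂ) (D ω) ∂P = 0 := by
    rw [show (fun ω => Z ω * (starRingEnd ℂ) (D ω)) = fun ω => Z ω * (starRingEnd ℂ) (W ω) -
        ρh τ * (Z ω * (starRingEnd ℂ) (Z ω)) by
      funext ω; simp only [hDdef, hb, map_sub, map_mul, Complex.conj_conj]; ring,
      integral_sub iZWc (iZZc.const_mul _), integral_const_mul, eZWc, eZZc]
    simp
  have eWD : ∫ ω, W ω * D ω ∂P = 0 := by
    rw [show (fun ω => W ω * D ω) = fun ω => W ω * W ω - b * (Z ω * W ω) by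
      funext ω; simp only [hDdef]; ring, integral_sub iWW (iZW.const_mul b), integral_const_mul,
      eZW, eWW]
    simp
  have eWDc : ∫ ω, W ω * (starRingEnd ℂ) (D ω) ∂P = 1 - ρh τ * b := by
    rw [show (fun ω => W ω * (starRingEnd ℂ) (D ω)) = fun ω => W ω * (starRingEnd ℂ) (W ω) -
        ρh τ * (W ω * (starRingEnd ℂ) (Z ω)) by
      funext ω; simp only [hDdef, hb, map_sub, map_mul, Complex.conj_conj]; ring,
      integral_sub iWWc (iWZc.const_mul _), integral_const_mul, eWZc, eWWc]
  have eDD : ∫ ω, D ω * D ω ∂P = 0 := by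
    rw [show (fun ω => D ω * D ω) = fun ω => W ω * D ω - b * (Z ω * D ω) by
      funext ω; simp only [hDdef]; ring, integral_sub iWD (iZD.const_mul b), integral_const_mul,
      eWD, eZD]
    simp
  have eDDc : ∫ ω, ‖D ω‖ ^ 2 ∂P = 1 - ‖ρh τ‖ ^ 2 := by
    have h1 : ∫ ω, D ω * (starRingEnd ℂ) (D ω) ∂P = 1 - ρh τ * b := by
      rw [show (fun ω => D ω * (starRingEnd ℂ) (D ω)) = fun ω => W ω * (starRingEnd ℂ) (D ω) -
          b * (Z ω * (starRingEnd ℂ) (D ω)) by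
        funext ω; simp only [hDdef]; ring, integral_sub iWDc (iZDc.const_mul b),
        integral_const_mul, eWDc, eZDc]
      simp
    rw [normSq, hb, Complex.mul_conj, Complex.normSq_eq_norm_sq] at h1
    exact_mod_cast h1
  have hp1 : ‖ρh τ‖ ^ 2 < 1 := by
    rw [sq_lt_one_iff₀ (norm_nonneg _)]; exact hlt
  have hWeq : (fun ω => b * Z ω + D ω) = W := by
    funext ω; simp only [hDdef]; ring
  have hfin := integral_log_norm_sq_mul_log_norm_sq (P := P) (Z := Z) (D := D) (b := b)
    (p := ‖ρh τ‖ ^ 2) (by rw [hb, RCLike.norm_conj]) hp1 hZ.aemeasurable hD.aemeasurable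
    (hh.map_eq_circGauss t)
    (HasGaussianLaw.map_eq_circGauss (by linarith) hD eD0 eDD eDDc)
    (by rw [hWeq]; exact hh.map_eq_circGauss (t - τ))
    (HasGaussianLaw.indepFun_of_integral_mul_eq_zero hZD (hh.zero_mean t) eZD eZDc)
  rw [← hfin]
  congr 1; funext ω
  rw [← congrFun hWeq ω]

lemma IsRayleighFading.memLp_imi (hh : IsRayleighFading P h ρh) (Ts : ℝ) {η : ℝ} (hη : 0 < η)
    (l : ℤ) : MemLp (imi h Ts η l) 2 P := by
  have h1 := (memLp_log_one_add_mul (hh.aemeasurable_norm_sq (l * Ts))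
    (hh.map_norm_sq (l * Ts)) hη).mul_const (Real.log 2)⁻¹
  exact h1

/-- Zero variance would make the power `|h|²` almost surely constant, but the exponential law has no
atoms. -/
lemma IsRayleighFading.variance_imi_pos [IsProbabilityMeasure P] (hh : IsRayleighFading P h ρh)
    (Ts : ℝ) {η : ℝ} (hη : 0 < η) (l : ℤ) : 0 < variance (imi h Ts η l) P := by
  refine lt_of_le_of_ne (variance_nonneg _ _) fun h0 => ?_
  have h1 := ae_eq_integral_of_variance_eq_zero (hh.memLp_imi Ts hη l) h0.symm
  set m := ∫ ω, imi h Ts η l ω ∂P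
  have h2 : ∀ᵐ ω ∂P, ‖h (l * Ts) ω‖ ^ 2 = (Real.exp (m * Real.log 2) - 1) / η := by
    filter_upwards [h1] with ω hω
    rw [imi_eq, div_eq_iff (Real.log_pos one_lt_two).ne'] at hω
    rw [← hω, Real.exp_log (by positivity)]
    field_simp
    ring
  have h3 : ∀ᵐ x ∂stdExp, x = (Real.exp (m * Real.log 2) - 1) / η := by
    rw [← hh.map_norm_sq (l * Ts)]
    exact (ae_map_iff (hh.aemeasurable_norm_sq (l * Ts)) measurableSet_eq).mpr h2
  have h4 : ∀ᵐ x ∂stdExp, x ≠ (Real.exp (m * Real.log 2) - 1) / η :=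
    measure_eq_zero_iff_ae_notMem.mp (measure_singleton _)
  obtain ⟨x, hx, hx'⟩ := (h3.and h4).exists
  exact hx' hx

lemma logb_two_exp_one : Real.logb 2 (Real.exp 1) = (Real.log 2)⁻¹ := by
  simp [Real.logb]

lemma log_div_gammaConst {η : ℝ} (hη : 0 < η) :
    Real.log (η / gammaConst) = Real.log η - Real.eulerMascheroniConstant := by
  rw [gammaConst, Real.log_div hη.ne' (Real.exp_pos _).ne', Real.log_exp]

lemma integral_imi_mul_imi_div (Ts η : ℝ) (l k : ℤ) :
    (∫ ω, imi h Ts η l ω * imi h Ts η k ω ∂P) / Real.logb 2 (Real.exp 1) ^ 2 =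
      ∫ ω, Real.log (1 + η * ‖h (l * Ts) ω‖ ^ 2) * Real.log (1 + η * ‖h (k * Ts) ω‖ ^ 2) ∂P := by
  have hl : Real.log 2 ≠ 0 := (Real.log_pos one_lt_two).ne'
  rw [logb_two_exp_one, ← integral_div]
  congr 1; funext ω
  rw [imi_eq, imi_eq]
  field_simp

lemma IsRayleighFading.tendsto_integral_imi_mul_imi [IsProbabilityMeasure P]
    (hh : IsRayleighFading P h ρh) (Ts : ℝ) (l k : ℤ) {K : ℝ}
    (hK : ∫ ω, Real.log (‖h (l * Ts) ω‖ ^ 2) * Real.log (‖h (k * Ts) ω‖ ^ 2) ∂P =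
      Real.eulerMascheroniConstant ^ 2 + K) :
    Tendsto (fun η : ℝ => (∫ ω, imi h Ts η l ω * imi h Ts η k ω ∂P) /
      Real.logb 2 (Real.exp 1) ^ 2 - (K + Real.log (η / gammaConst) ^ 2)) atTop (𝓝 0) := by
  refine (tendsto_integral_log_one_add_mul_mul (hh.aemeasurable_norm_sq (l * Ts))
    (hh.aemeasurable_norm_sq (k * Ts)) (hh.map_norm_sq _) (hh.map_norm_sq _)).congr' ?_
  filter_upwards [eventually_gt_atTop 0] with η hη
  rw [hK, integral_imi_mul_imi_div, log_div_gammaConst hη]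
  ring

lemma IsRayleighFading.integral_log_sq (hh : IsRayleighFading P h ρh) (t : ℝ) :
    ∫ ω, Real.log (‖h t ω‖ ^ 2) * Real.log (‖h t ω‖ ^ 2) ∂P =
      Real.eulerMascheroniConstant ^ 2 + Real.pi ^ 2 / 6 := by
  rw [← integral_log_sq_stdExp]
  exact integral_comp_of_map_eq_stdExp (f := fun x => Real.log x * Real.log x)
    (hh.aemeasurable_norm_sq t) (hh.map_norm_sq t) (by fun_prop)

lemma IsRayleighFading.integral_imi_div (hh : IsRayleighFading P h ρh) (Ts η : ℝ) (l : ℤ) :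
    (∫ ω, imi h Ts η l ω ∂P) / Real.logb 2 (Real.exp 1) =
      ∫ x, Real.log (1 + η * x) ∂stdExp := by
  have hl : Real.log 2 ≠ 0 := (Real.log_pos one_lt_two).ne'
  rw [← integral_comp_of_map_eq_stdExp (f := fun x => Real.log (1 + η * x))
    (hh.aemeasurable_norm_sq (l * Ts)) (hh.map_norm_sq _) (by fun_prop), logb_two_exp_one,
    ← integral_div]
  congr 1; funext ω
  rw [imi_eq]
  field_simp

end

lemma tendsto_log_div_gammaConst :
    Tendsto (fun η : ℝ => Real.log (η / gammaConst)) atTop atTop :=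
  Real.tendsto_log_atTop.comp (tendsto_id.atTop_div_const (Real.exp_pos _))

lemma tendsto_integral_log_sub_log_div_gammaConst :
    Tendsto (fun η : ℝ => ∫ x, Real.log (1 + η * x) ∂stdExp - Real.log (η / gammaConst))
        atTop (𝓝 0) ∧
    Tendsto (fun η : ℝ => Real.log (η / gammaConst) *
      (∫ x, Real.log (1 + η * x) ∂stdExp - Real.log (η / gammaConst))) atTop (𝓝 0) := by
  have h1 : Tendsto (fun η : ℝ => ∫ x, Real.log (1 + η * x) ∂stdExp -
      Real.log (η / gammaConst)) atTop (𝓝 0) := by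
    have hinv : Tendsto (fun η : ℝ => (1 + Real.log η)⁻¹) atTop (𝓝 0) :=
      (tendsto_atTop_add_const_left _ 1 Real.tendsto_log_atTop).inv_tendsto_atTop
    have h := tendsto_mul_integral_log_one_add_mul_sub.mul hinv
    rw [zero_mul] at h
    refine h.congr' ?_
    filter_upwards [eventually_ge_atTop 1] with η hη
    have hne : 1 + Real.log η ≠ 0 := by linarith [Real.log_nonneg hη]
    rw [log_div_gammaConst (by linarith)]
    field_simp
  refine ⟨h1, ?_⟩
  -- The weight is changed by `log (η/γ) = (1 + log η) - (1 + C)`.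
  have h := tendsto_mul_integral_log_one_add_mul_sub.sub
    (h1.const_mul (1 + Real.eulerMascheroniConstant))
  rw [mul_zero, sub_zero] at h
  refine h.congr' ?_
  filter_upwards [eventually_gt_atTop 0] with η hη
  rw [log_div_gammaConst hη]
  ring

theorem mainTheorem5 {Ω : Type*} [MeasurableSpace Ω] (P : Measure Ω) [IsProbabilityMeasure P]
    (h : ℝ → Ω → ℂ) (ρh : ℝ → ℂ) (hh : IsRayleighFading P h ρh)
    (Ts : ℝ) (hTs : 0 < Ts) (l i : ℤ) (ϱ : ℝ) (hϱ : ϱ = ‖ρh (i * Ts)‖) (hϱ_lt : ϱ < 1) :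
    -- the moments and quotients below are genuine for every SNR `η > 0`
    (∀ η : ℝ, 0 < η →
      MemLp (imi h Ts η l) 2 P ∧ MemLp (imi h Ts η (l - i)) 2 P ∧
      0 < ∫ ω, imi h Ts η l ω ^ 2 ∂P ∧
      0 < (∫ ω, imi h Ts η l ω ^ 2 ∂P) - (∫ ω, imi h Ts η l ω ∂P) ^ 2) ∧
    -- the ACF and the second moment, up to `o(1)`
    Tendsto (fun η : ℝ => imiACF P h Ts η l i / Real.logb 2 (Real.exp 1) ^ 2 -
        (dilog (ϱ ^ 2) + Real.log (η / gammaConst) ^ 2)) atTop (𝓝 0) ∧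
    Tendsto (fun η : ℝ => (∫ ω, imi h Ts η l ω ^ 2 ∂P) / Real.logb 2 (Real.exp 1) ^ 2 -
        (Real.pi ^ 2 / 6 + Real.log (η / gammaConst) ^ 2)) atTop (𝓝 0) ∧
    -- the normalized ACF, up to `o(1 / ln² (η / γ))`
    Tendsto (fun η : ℝ => Real.log (η / gammaConst) ^ 2 *
        (imiNACF P h Ts η l i -
          (dilog (ϱ ^ 2) + Real.log (η / gammaConst) ^ 2) /
            (Real.pi ^ 2 / 6 + Real.log (η / gammaConst) ^ 2))) atTop (𝓝 0) ∧
    -- the correlation coefficient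
    Tendsto (fun η : ℝ => imiCorrCoeff P h Ts η l i) atTop
      (𝓝 (6 * dilog (ϱ ^ 2) / Real.pi ^ 2)) ∧
    -- the generating functions of `H_k` and `H_k²`
    (∀ t : ℝ, |t| < 1 →
      HasSum (fun k : ℕ => (harmonic k : ℝ) * t ^ k) (-Real.log (1 - t) / (1 - t)) ∧
      HasSum (fun k : ℕ => (harmonic k : ℝ) ^ 2 * t ^ k)
        ((dilog t + Real.log (1 - t) ^ 2) / (1 - t))) := by
  have hc : Real.logb 2 (Real.exp 1) ≠ 0 := by
    rw [logb_two_exp_one]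
    exact inv_ne_zero (Real.log_pos one_lt_two).ne'
  have hlog : ∫ ω, Real.log (‖h (l * Ts) ω‖ ^ 2) * Real.log (‖h ((l - i : ℤ) * Ts) ω‖ ^ 2) ∂P =
      Real.eulerMascheroniConstant ^ 2 + dilog (ϱ ^ 2) := by
    rw [hϱ, show ((l - i : ℤ) : ℝ) * Ts = l * Ts - i * Ts by push_cast; ring]
    exact hh.integral_log_mul_log (hϱ ▸ hϱ_lt)
  have ha : Tendsto (fun η : ℝ => imiACF P h Ts η l i / Real.logb 2 (Real.exp 1) ^ 2 -
      (dilog (ϱ ^ 2) + Real.log (η / gammaConst) ^ 2)) atTop (𝓝 0) :=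
    hh.tendsto_integral_imi_mul_imi Ts l (l - i) hlog
  have hb : Tendsto (fun η : ℝ => (∫ ω, imi h Ts η l ω ^ 2 ∂P) / Real.logb 2 (Real.exp 1) ^ 2 -
      (Real.pi ^ 2 / 6 + Real.log (η / gammaConst) ^ 2)) atTop (𝓝 0) := by
    simp_rw [pow_two (imi h Ts _ l _)]
    exact hh.tendsto_integral_imi_mul_imi Ts l l (hh.integral_log_sq _)
  have hL := tendsto_log_div_gammaConst
  obtain ⟨hm1, hm2⟩ := tendsto_integral_log_sub_log_div_gammaConst
  refine ⟨fun η hη => ?_, ha, hb, ?_, ?_, fun t ht =>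
    ⟨hasSum_harmonic_mul_pow ht, hasSum_harmonic_sq_mul_pow ht⟩⟩
  · have hmem := hh.memLp_imi Ts hη l
    have hvar := hh.variance_imi_pos Ts hη l
    rw [variance_eq_sub hmem] at hvar
    simp only [Pi.pow_apply] at hvar
    refine ⟨hmem, hh.memLp_imi Ts hη (l - i), ?_, hvar⟩
    linarith [sq_nonneg (∫ ω, imi h Ts η l ω ∂P)]
  · refine (tendsto_sq_mul_div_sub_div hL ha hb).congr fun η => ?_
    rw [imiNACF, div_div_div_cancel_right₀ (pow_ne_zero 2 hc)]
  -- Subtracting the squared mean removes `ln² (η/γ)` from numerator and denominator, leaving the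
  -- two covariances; the factor `(log₂ e)²` cancels in the quotient.
  · have h1 := tendsto_sub_sq_of_tendsto ha hm1 hm2
    have h2 := tendsto_sub_sq_of_tendsto hb hm1 hm2
    have hpi : Real.pi ^ 2 / 6 ≠ 0 := by positivity
    have h3 := h1.div h2 hpi
    rw [show dilog (ϱ ^ 2) / (Real.pi ^ 2 / 6) = 6 * dilog (ϱ ^ 2) / Real.pi ^ 2 by
      field_simp] at h3
    refine h3.congr fun η => ?_
    simp only [Pi.div_apply]
    rw [imiCorrCoeff, ← hh.integral_imi_div Ts η l, div_pow, ← sub_div, ← sub_div,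
      div_div_div_cancel_right₀ (pow_ne_zero 2 hc)]
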